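/- Let $p\in[1,\infty)$, and write $x_+=\max\{0,x\}$. For Borel probability measures $P,Q$ on $\mathbb{R}^m$ let $\Gamma(P,Q)$ be the set of their couplings, and put, with the Euclidean norm, $$W_p(P,Q)=\Bigl(\inf_{\gamma\in\Gamma(P,Q)}\mathbb{E}_{(\xi,\zeta)\sim\gamma}\|\xi-\zeta\|^p\Bigr)^{1/p},\qquad W_\infty(P,Q)=\inf_{\gamma\in\Gamma(P,Q)}\operatorname*{ess\,sup}_{(\xi,\zeta)\sim\gamma}\|\xi-\zeta\|.$$ For a weight vector $w=(w_1,\dots,w_T)$ with $w_t\ge 0$ and $\sum_t w_t=1$, define the effective sample size and the weighted drift $$T_{\mathrm{eff}}(w)=\frac{1}{\sum_{t=1}^T w_t^2},\qquad D_p(w)=\Bigl(\sum_{t=1}^T w_t\,(T-t+1)^p\Bigr)^{1/p}.$$ **Theorem (Concentration for Drifting Distributions).** Let $m\ge 1$, let $\Xi\subset\mathbb{R}^m$ be closed and bounded, and let $q\in(0,1/2)$ satisfy $q\le p/m$. There exist a constant $c_1>0$ depending only on $\operatorname{diam}(\Xi)$ and $p$, and a constant $c_2>0$ depending only on $m$,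 $\operatorname{diam}(\Xi)$, $p$ and $q$, such that the following holds for all $T\in\mathbb{N}$, all $\rho\ge 0$, all Borel probability measures $P_1,\dots,P_{T+1}$ on $\Xi$ with $W_\infty(P_t,P_{t+1})\le\rho$ for $t=1,\dots,T$, all independent random vectors $\xi_1\sim P_1,\dots,\xi_T\sim P_T$, all weight vectors $w=(w_1,\dots,w_T)$ as above, and all $\varepsilon\ge 0$: $$\Pr\Bigl[W_p\Bigl(\sum_{t=1}^T w_t\delta_{\xi_t},P_{T+1}\Bigr)\ge\varepsilon\Bigr]\le\exp\Bigl(-c_1\,T_{\mathrm{eff}}(w)\Bigl(\bigl((\varepsilon-D_p(w)\rho)_+\bigr)^p-c_2\,T_{\mathrm{eff}}(w)^{-q}\Bigr)_+^2\Bigr).$$ Moreover, whenever $\varepsilon\ge D_p(w)\rho+2\bigl(c_2T_{\mathrm{eff}}(w)^{-q}\bigr)^{1/p}$, $$\Pr\Bigl[W_p\Bigl(\sum_{t=1}^T w_t\delta_{\xi_t},P_{T+1}\Bigr)\ge\varepsilon\Bigr]\le\exp\Bigl(-\frac{c_1}{4}\,T_{\mathrm{eff}}(w)\,(\varepsilon-D_p(w)\rho)_+^{2p}\Bigr).$$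 -/

import Mathlib

open MeasureTheory ProbabilityTheory
open scoped ENNReal

noncomputable section

/-- The couplings `Γ(P, Q)`: measures on `E × E` with first marginal `P` and second marginal `Q`. -/
def couplings {E : Type*} [MeasurableSpace E] (P Q : Measure E) : Set (Measure (E × E)) :=
  {γ | γ.map Prod.fst = P ∧ γ.map Prod.snd = Q}

/-- The `p`-Wasserstein distance
`W_p(P, Q) = (inf over γ ∈ Γ(P, Q) of E_γ[‖ξ - ζ‖ ^ p]) ^ (1 / p)`, with values in `[0, ∞]`. -/
def wassersteinDist {E : Type*} [NormedAddCommGroup E] [MeasurableSpace E]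
    (p : ℝ) (P Q : Measure E) : ℝ≥0∞ :=
  (⨅ γ ∈ couplings P Q, ∫⁻ z, ‖z.1 - z.2‖ₑ ^ p ∂γ) ^ (1 / p)

/-- The `∞`-Wasserstein distance
`W_∞(P, Q) = inf over γ ∈ Γ(P, Q) of ess sup ‖ξ - ζ‖`, with values in `[0, ∞]`. -/
def wassersteinDistTop {E : Type*} [NormedAddCommGroup E] [MeasurableSpace E]
    (P Q : Measure E) : ℝ≥0∞ :=
  ⨅ γ ∈ couplings P Q, essSup (fun z => ‖z.1 - z.2‖ₑ) γ

/-- The weighted empirical distribution `∑ t, w t • δ_{x t}`. -/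
def weightedEmpirical {E : Type*} [MeasurableSpace E] {T : ℕ}
    (w : Fin T → ℝ) (x : Fin T → E) : Measure E :=
  ∑ t, ENNReal.ofReal (w t) • Measure.dirac (x t)

/-- The effective sample size `T_eff(w) = 1 / ∑ t, (w t) ^ 2`. -/
def effectiveSampleSize {T : ℕ} (w : Fin T → ℝ) : ℝ :=
  1 / ∑ t, w t ^ 2

/-- The weighted drift `D_p(w) = (∑ t, w_t (T - t + 1) ^ p) ^ (1 / p)`, where `t` runs through
`1, …, T`. The index `t : Fin T` starts at `0`, so that the look-back time is `T - t` here. -/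
def weightedDrift {T : ℕ} (p : ℝ) (w : Fin T → ℝ) : ℝ :=
  (∑ t : Fin T, w t * ((T : ℝ) - (t : ℝ)) ^ p) ^ (1 / p)

end

/-!
The weighted sample `∑ t, w t • δ_{ξ t}` is compared with `P_{T+1}` through the mixture
`ν = ∑ t, w t • P_t`. By the triangle inequality the `p`-Wasserstein distance is at most the
distance from the sample to `ν` plus the distance from `ν` to `P_{T+1}`. Gluing the couplings of
consecutive measures along the chain bounds the second distance by `D_p(w) * ρ`
(`wassersteinDist_drift_le`).

For the first distance, a coupling of a discrete measure with `ν` is a splitting of `ν` into pieces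
of mass `w t`, and the optimal cost over all splittings (`semidiscreteCost`) is a measurable
function of the sample which changes by at most `w t * diam ^ p` when `ξ t` is changed. The bounded
differences inequality (`hasSubgaussianMGF_of_bounded_differences`) therefore makes it concentrate
around its mean at the scale `T_eff(w)`.

The mean is estimated by a multiscale argument. For nested dyadic partitions there is a transport
plan that is good at all scales simultaneously (`exists_multiscale_transport`), so the cost is
bounded by a weighted sum over the levels `n` of the discrepancies of cell masses, the weights
being of order `2 ^ (-p * n)` (`semidiscreteCost_le_multiscale`). By the Cauchy-Schwarz inequality
the expected discrepancy over the `2 ^ (m * n)` cells of level `n` is at most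
`(2 ^ (m * n) / T_eff(w)) ^ (1 / 2)`, and summing up to the level with about `T_eff(w)` cells gives
the rate `T_eff(w) ^ (-q)` (`exists_level_sum_le`).
-/

/-! ### Gluing of couplings, the triangle inequality and the drift -/

section Wasserstein

/-- Gluing lemma: two couplings that share the middle marginal are the two-dimensional marginals
of one measure. It is built by drawing the outer coordinates independently of each other given the
middle one. -/
theorem exists_gluing {E : Type*} [MeasurableSpace E] [StandardBorelSpace E] [Nonempty E]
    {γ₁ γ₂ : Measure (E × E)} [IsFiniteMeasure γ₁] [IsFiniteMeasure γ₂]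
    (h : γ₁.map Prod.snd = γ₂.map Prod.fst) :
    ∃ π : Measure ((E × E) × E),
      π.map Prod.fst = γ₁ ∧ π.map (fun z => (z.1.2, z.2)) = γ₂ := by
  refine ⟨γ₁ ⊗ₘ (γ₂.condKernel.comap Prod.snd measurable_snd), Measure.fst_compProd _ _, ?_⟩
  ext s hs
  have hm : Measurable fun z : (E × E) × E => (z.1.2, z.2) := by fun_prop
  rw [Measure.map_apply hm hs, Measure.compProd_apply (hm hs)]
  conv_rhs => rw [← γ₂.disintegrate γ₂.condKernel, Measure.compProd_apply hs, Measure.fst, ← h,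
    lintegral_map (Kernel.measurable_kernel_prodMk_left hs) measurable_snd]
  rfl

theorem isFiniteMeasure_of_mem_couplings {E : Type*} [MeasurableSpace E]
    {P Q : Measure E} [IsFiniteMeasure P]
    {γ : Measure (E × E)} (h : γ ∈ couplings P Q) : IsFiniteMeasure γ := by
  constructor
  have : γ Set.univ = P Set.univ := by
    rw [← h.1, Measure.map_apply measurable_fst .univ, Set.preimage_univ]
  rw [this]; exact measure_lt_top _ _

variable {E : Type*} [NormedAddCommGroup E] [MeasurableSpace E]

theorem wassersteinDist_eq_iInf {p : ℝ} (hp : 0 < p) (P Q : Measure E) :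
    wassersteinDist p P Q =
      ⨅ γ ∈ couplings P Q, (∫⁻ z, ‖z.1 - z.2‖ₑ ^ p ∂γ) ^ (1 / p) := by
  simp only [wassersteinDist, ← ENNReal.orderIsoRpow_apply (1 / p) (by positivity),
    OrderIso.map_iInf]

theorem wassersteinDist_le {p : ℝ} (hp : 0 < p) {P Q : Measure E} {γ : Measure (E × E)}
    (h : γ ∈ couplings P Q) {c : ℝ≥0∞} (hc : ∫⁻ z, ‖z.1 - z.2‖ₑ ^ p ∂γ ≤ c) :
    wassersteinDist p P Q ≤ c ^ (1 / p) :=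
  ENNReal.rpow_le_rpow ((iInf₂_le γ h).trans hc) (by positivity)

/-- A mixture of couplings is a coupling of the mixture. -/
theorem wassersteinDist_mixture_le {p : ℝ} (hp : 0 < p) {T : ℕ} {P : Fin T → Measure E}
    {Q : Measure E} {w : Fin T → ℝ} (hw : w ∈ stdSimplex ℝ (Fin T)) {d : Fin T → ℝ}
    (hd : ∀ t, 0 ≤ d t)
    (h : ∀ t, ∃ γ ∈ couplings (P t) Q, ∀ᵐ z ∂γ, ‖z.1 - z.2‖ₑ ≤ ENNReal.ofReal (d t))
    [∀ t, IsProbabilityMeasure (P t)] :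
    wassersteinDist p (∑ t, ENNReal.ofReal (w t) • P t) Q ≤
      ENNReal.ofReal ((∑ t, w t * d t ^ p) ^ (1 / p)) := by
  choose γ hγ hγd using h
  have hsum : ∑ t, ENNReal.ofReal (w t) = 1 := by
    rw [← ENNReal.ofReal_sum_of_nonneg fun t _ => hw.1 t, hw.2, ENNReal.ofReal_one]
  have hmap (f : E × E → E) (hf : Measurable f) :
      (∑ t, ENNReal.ofReal (w t) • γ t).map f = ∑ t, ENNReal.ofReal (w t) • (γ t).map f := by
    ext s hs
    simp [Measure.map_apply hf hs, Measure.finsetSum_apply]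
  have hS : 0 ≤ ∑ t, w t * d t ^ p :=
    Finset.sum_nonneg fun t _ => mul_nonneg (hw.1 t) (Real.rpow_nonneg (hd t) _)
  rw [← ENNReal.ofReal_rpow_of_nonneg hS (by positivity)]
  refine wassersteinDist_le hp (γ := ∑ t, ENNReal.ofReal (w t) • γ t) ⟨?_, ?_⟩ ?_
  · rw [hmap _ measurable_fst]; simp only [(hγ _).1]
  · rw [hmap _ measurable_snd]; simp only [(hγ _).2]
    rw [← Finset.sum_smul, hsum, one_smul]
  · rw [lintegral_finsetSum_measure,
      ENNReal.ofReal_sum_of_nonneg fun t _ => mul_nonneg (hw.1 t) (Real.rpow_nonneg (hd t) _)]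
    refine Finset.sum_le_sum fun t _ => ?_
    have := isFiniteMeasure_of_mem_couplings (hγ t)
    have h1 : γ t Set.univ = 1 := by
      have := congrArg (fun ν => ν Set.univ) (hγ t).1
      simpa [Measure.map_apply measurable_fst .univ] using this
    rw [lintegral_smul_measure, smul_eq_mul, ENNReal.ofReal_mul (hw.1 t)]
    gcongr
    calc ∫⁻ z, ‖z.1 - z.2‖ₑ ^ p ∂γ t ≤ ∫⁻ _, ENNReal.ofReal (d t ^ p) ∂γ t := by
          refine lintegral_mono_ae ?_
          filter_upwards [hγd t] with z hz
          rw [← ENNReal.ofReal_rpow_of_nonneg (hd t) hp.le]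
          exact ENNReal.rpow_le_rpow hz hp.le
      _ = _ := by simp [h1]

variable [BorelSpace E] [SecondCountableTopology E] [CompleteSpace E]

theorem wassersteinDist_triangle {p : ℝ} (hp : 1 ≤ p) (P Q R : Measure E)
    [IsFiniteMeasure P] [IsFiniteMeasure Q] :
    wassersteinDist p P R ≤ wassersteinDist p P Q + wassersteinDist p Q R := by
  have hp0 : 0 < p := by linarith
  simp only [wassersteinDist_eq_iInf hp0 P Q, wassersteinDist_eq_iInf hp0 Q R,
    ENNReal.iInf_add, ENNReal.add_iInf]
  refine le_iInf₂ fun γ₂ h₂ => le_iInf₂ fun γ₁ h₁ => ?_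
  have := isFiniteMeasure_of_mem_couplings h₁
  have := isFiniteMeasure_of_mem_couplings h₂
  obtain ⟨π, hπ₁, hπ₂⟩ := exists_gluing (h₁.2.trans h₂.1.symm)
  have hm : Measurable fun z : (E × E) × E => (z.1.2, z.2) := by fun_prop
  have hm' : Measurable fun z : (E × E) × E => (z.1.1, z.2) := by fun_prop
  have hc : Measurable fun z : E × E => ‖z.1 - z.2‖ₑ ^ p := by fun_prop
  refine (wassersteinDist_le hp0 (γ := π.map fun z => (z.1.1, z.2)) ⟨?_, ?_⟩ le_rfl).trans ?_
  · rw [Measure.map_map measurable_fst hm', ← h₁.1, ← hπ₁,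
      Measure.map_map measurable_fst measurable_fst]
    rfl
  · rw [Measure.map_map measurable_snd hm', ← h₂.2, ← hπ₂, Measure.map_map measurable_snd hm]
    rfl
  · rw [lintegral_map hc hm', ← hπ₁, ← hπ₂, lintegral_map hc measurable_fst, lintegral_map hc hm]
    refine le_trans (ENNReal.rpow_le_rpow (lintegral_mono fun z => ?_) (by positivity))
      (ENNReal.lintegral_Lp_add_le (f := fun z : (E × E) × E => ‖z.1.1 - z.1.2‖ₑ)
        (g := fun z => ‖z.1.2 - z.2‖ₑ) (by fun_prop) (by fun_prop) hp)
    refine ENNReal.rpow_le_rpow ?_ hp0.le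
    simpa using enorm_add_le (z.1.1 - z.1.2) (z.1.2 - z.2)

/-- Couplings of consecutive measures in which the points move by less than `r` glue to a
coupling of `P t` with the last measure in which the points move by at most `(T - t) * r`. The
strict bound on `wassersteinDistTop` is what yields couplings, as the infimum need not be known to
be attained. -/
theorem exists_coupling_of_chain {T : ℕ} {P : Fin (T + 1) → Measure E}
    [∀ t, IsProbabilityMeasure (P t)] {r : ℝ≥0∞}
    (h : ∀ t : Fin T, wassersteinDistTop (P t.castSucc) (P t.succ) < r) (t : Fin (T + 1)) :
    ∃ γ ∈ couplings (P t) (P (Fin.last T)), ∀ᵐ z ∂γ, ‖z.1 - z.2‖ₑ ≤ ((T - t : ℕ) : ℝ≥0∞) * r := by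
  induction t using Fin.reverseInduction with
  | last =>
    have hm : Measurable fun x : E => (x, x) := by fun_prop
    refine ⟨(P (Fin.last T)).map fun x => (x, x), ⟨?_, ?_⟩, ?_⟩
    · rw [Measure.map_map measurable_fst hm]; exact Measure.map_id
    · rw [Measure.map_map measurable_snd hm]; exact Measure.map_id
    · rw [ae_map_iff hm.aemeasurable (measurableSet_le (by fun_prop) (by fun_prop))]
      simp
  | cast t ih =>
    obtain ⟨γ₂, h₂, hγ₂⟩ := ih
    have := h t
    simp only [wassersteinDistTop, iInf_lt_iff] at this
    obtain ⟨γ₁, h₁, hlt⟩ := this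
    have hγ₁ : ∀ᵐ z ∂γ₁, ‖z.1 - z.2‖ₑ ≤ r := by
      filter_upwards [ae_le_essSup (f := fun z : E × E => ‖z.1 - z.2‖ₑ) (μ := γ₁)] with z hz
      exact hz.trans hlt.le
    have := isFiniteMeasure_of_mem_couplings h₁
    have := isFiniteMeasure_of_mem_couplings h₂
    obtain ⟨π, hπ₁, hπ₂⟩ := exists_gluing (h₁.2.trans h₂.1.symm)
    have hm : Measurable fun z : (E × E) × E => (z.1.2, z.2) := by fun_prop
    have hm' : Measurable fun z : (E × E) × E => (z.1.1, z.2) := by fun_prop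
    refine ⟨π.map fun z => (z.1.1, z.2), ⟨?_, ?_⟩, ?_⟩
    · rw [Measure.map_map measurable_fst hm', ← h₁.1, ← hπ₁,
        Measure.map_map measurable_fst measurable_fst]
      rfl
    · rw [Measure.map_map measurable_snd hm', ← h₂.2, ← hπ₂, Measure.map_map measurable_snd hm]
      rfl
    · rw [← hπ₁] at hγ₁
      rw [← hπ₂] at hγ₂
      rw [ae_map_iff hm'.aemeasurable (measurableSet_le (by fun_prop) (by fun_prop))]
      filter_upwards [ae_of_ae_map measurable_fst.aemeasurable hγ₁,
        ae_of_ae_map hm.aemeasurable hγ₂] with z hz₁ hz₂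
      have he : T - (t.castSucc : ℕ) = (T - (t.succ : ℕ)) + 1 := by
        have := t.2
        simp only [Fin.val_castSucc, Fin.val_succ]; omega
      calc ‖z.1.1 - z.2‖ₑ = ‖(z.1.1 - z.1.2) + (z.1.2 - z.2)‖ₑ := by simp
        _ ≤ r + ((T - (t.succ : ℕ) : ℕ) : ℝ≥0∞) * r := (enorm_add_le _ _).trans (add_le_add hz₁ hz₂)
        _ = _ := by rw [he]; push_cast; ring

/-- The bias caused by the drift. The chained couplings give the bound with any `r > ρ` in place
of `ρ`, and `r` then decreases to `ρ`. -/
theorem wassersteinDist_drift_le {p : ℝ} (hp : 0 < p) {T : ℕ} {P : Fin (T + 1) → Measure E}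
    [∀ t, IsProbabilityMeasure (P t)] {ρ : ℝ} (hρ : 0 ≤ ρ)
    (h : ∀ t : Fin T, wassersteinDistTop (P t.castSucc) (P t.succ) ≤ ENNReal.ofReal ρ)
    {w : Fin T → ℝ} (hw : w ∈ stdSimplex ℝ (Fin T)) :
    wassersteinDist p (∑ t, ENNReal.ofReal (w t) • P t.castSucc) (P (Fin.last T)) ≤
      ENNReal.ofReal (weightedDrift p w * ρ) := by
  have key : ∀ r > ρ, wassersteinDist p (∑ t, ENNReal.ofReal (w t) • P t.castSucc)
      (P (Fin.last T)) ≤ ENNReal.ofReal (weightedDrift p w * r) := by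
    intro r hr
    have hr0 : 0 ≤ r := hρ.trans hr.le
    have hT (t : Fin T) : (0 : ℝ) ≤ (T : ℝ) - (t : ℝ) := by
      have : ((t : ℕ) : ℝ) ≤ T := by exact_mod_cast t.2.le
      linarith
    have hlt : ∀ t : Fin T, wassersteinDistTop (P t.castSucc) (P t.succ) < ENNReal.ofReal r :=
      fun t => (h t).trans_lt ((ENNReal.ofReal_lt_ofReal_iff (hρ.trans_lt hr)).2 hr)
    refine (wassersteinDist_mixture_le hp hw (d := fun t => ((T : ℝ) - (t : ℝ)) * r)
      (fun t => mul_nonneg (hT t) hr0) fun t => ?_).trans_eq ?_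
    · obtain ⟨γ, hγ, hd⟩ := exists_coupling_of_chain hlt t.castSucc
      refine ⟨γ, hγ, ?_⟩
      filter_upwards [hd] with z hz
      refine hz.trans_eq ?_
      rw [ENNReal.ofReal_mul (hT t), ← ENNReal.ofReal_natCast, Fin.val_castSucc,
        Nat.cast_sub t.2.le]
    · congr 1
      simp only [Real.mul_rpow (hT _) hr0, ← mul_assoc]
      rw [← Finset.sum_mul, Real.mul_rpow (Finset.sum_nonneg fun t _ => mul_nonneg (hw.1 t)
        (Real.rpow_nonneg (hT t) _)) (Real.rpow_nonneg hr0 _), ← Real.rpow_mul hr0,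
        mul_one_div_cancel hp.ne', Real.rpow_one]
      rfl
  -- The inequality is closed, so it passes to the limit `r → ρ`.
  have hcont : Filter.Tendsto (fun r => ENNReal.ofReal (weightedDrift p w * r))
      (nhdsWithin ρ (Set.Ioi ρ)) (nhds (ENNReal.ofReal (weightedDrift p w * ρ))) :=
    ((ENNReal.continuous_ofReal.comp (continuous_const.mul continuous_id)).tendsto ρ).mono_left
      nhdsWithin_le_nhds
  exact ge_of_tendsto hcont (Filter.eventually_of_mem self_mem_nhdsWithin key)

end Wasserstein

/-! ### The bounded differences inequality -/

section BoundedDifferences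

open scoped NNReal

theorem integrable_exp_mul_of_bounded {Ω : Type*} [MeasurableSpace Ω] {μ : Measure Ω}
    [IsFiniteMeasure μ] {f : Ω → ℝ} (hf : Measurable f) {M : ℝ} (hM : ∀ x, |f x| ≤ M) (t : ℝ) :
    Integrable (fun x => Real.exp (t * f x)) μ := by
  refine integrable_exp_mul_of_mem_Icc (a := -M) (b := M) hf.aemeasurable (.of_forall fun x => ?_)
  exact abs_le.1 (hM x)

/-- The variance proxies add up when a function on a product is centred first in one coordinate
and then in the other; the two centred parts need not be independent. -/
theorem hasSubgaussianMGF_prod {X Y : Type*} [MeasurableSpace X] [MeasurableSpace Y]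
    {μ : Measure X} {ν : Measure Y} [IsProbabilityMeasure μ] [IsProbabilityMeasure ν]
    {f : X × Y → ℝ} (hf : Measurable f) {M : ℝ} (hM : ∀ z, |f z| ≤ M) {c₁ c₂ : ℝ≥0}
    (h₁ : ∀ y, HasSubgaussianMGF (fun x => f (x, y) - ∫ x', f (x', y) ∂μ) c₁ μ)
    (h₂ : HasSubgaussianMGF
      (fun y => (∫ x, f (x, y) ∂μ) - ∫ y', ∫ x, f (x, y') ∂μ ∂ν) c₂ ν) :
    HasSubgaussianMGF (fun z => f z - ∫ z', f z' ∂(μ.prod ν)) (c₁ + c₂) (μ.prod ν) := by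
  have hint : Integrable f (μ.prod ν) :=
    Integrable.of_bound hf.aestronglyMeasurable M (.of_forall hM)
  have hE : ∫ z, f z ∂(μ.prod ν) = ∫ y, ∫ x, f (x, y) ∂μ ∂ν := integral_prod_symm f hint
  have hexp (t : ℝ) :
      Integrable (fun z => Real.exp (t * (f z - ∫ z', f z' ∂(μ.prod ν)))) (μ.prod ν) :=
    integrable_exp_mul_of_bounded (hf.sub_const _) (M := M + |∫ z', f z' ∂(μ.prod ν)|)
      (fun z => (abs_sub _ _).trans (by gcongr; exact hM z)) t
  refine ⟨hexp, fun t => ?_⟩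
  rw [mgf, integral_prod_symm _ (hexp t), hE]
  calc ∫ y, ∫ x, Real.exp (t * (f (x, y) - ∫ y', ∫ x', f (x', y') ∂μ ∂ν)) ∂μ ∂ν
      ≤ ∫ y, Real.exp (c₁ * t ^ 2 / 2) *
          Real.exp (t * ((∫ x, f (x, y) ∂μ) - ∫ y', ∫ x', f (x', y') ∂μ ∂ν)) ∂ν := by
        refine integral_mono ?_ ((h₂.integrable_exp_mul t).const_mul _) fun y => ?_
        · have := (hexp t).integral_prod_right
          rwa [hE] at this
        · have := (h₁ y).mgf_le t
          rw [mgf] at this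
          calc _ = ∫ x, Real.exp (t * (f (x, y) - ∫ x', f (x', y) ∂μ)) *
                Real.exp (t * ((∫ x, f (x, y) ∂μ) - ∫ y', ∫ x', f (x', y') ∂μ ∂ν)) ∂μ := by
                congr with x
                rw [← Real.exp_add]; congr 1; ring
            _ ≤ _ := by
                rw [integral_mul_const]; gcongr
    _ ≤ Real.exp (c₁ * t ^ 2 / 2) * Real.exp (c₂ * t ^ 2 / 2) := by
        rw [integral_const_mul]; gcongr; exact h₂.mgf_le t
    _ = _ := by rw [← Real.exp_add]; congr 1; push_cast; ring

/-- Hoeffding's lemma, stated in terms of the oscillation. -/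
theorem hasSubgaussianMGF_of_oscillation_le {X : Type*} [MeasurableSpace X] {μ : Measure X}
    [IsProbabilityMeasure μ] {f : X → ℝ} (hf : Measurable f) {M : ℝ} (hM : ∀ x, |f x| ≤ M)
    {c : ℝ≥0} (h : ∀ x y, f x - f y ≤ c) :
    HasSubgaussianMGF (fun x => f x - ∫ x', f x' ∂μ) ((c / 2) ^ 2) μ := by
  have := μ.nonempty_of_neZero
  have hb : BddBelow (Set.range f) := ⟨-M, by rintro _ ⟨x, rfl⟩; exact (abs_le.1 (hM x)).1⟩
  have key := hasSubgaussianMGF_of_mem_Icc (μ := μ) (a := ⨅ x, f x) (b := (⨅ x, f x) + c)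
    hf.aemeasurable (.of_forall fun x => ⟨ciInf_le hb x, ?_⟩)
  · simpa using key
  · rw [← sub_le_iff_le_add]
    exact le_ciInf fun y => by linarith [h x y]

/-- McDiarmid's bounded differences inequality, in the form of a sub-Gaussian moment generating
function. The induction splits off the first coordinate: the average over it inherits the bounded
differences in the others. -/
theorem hasSubgaussianMGF_of_bounded_differences {X : Type*} [MeasurableSpace X] {n : ℕ}
    (P : Fin n → Measure X) [∀ i, IsProbabilityMeasure (P i)] {f : (Fin n → X) → ℝ}
    (hf : Measurable f) {M : ℝ} (hM : ∀ x, |f x| ≤ M) {c : Fin n → ℝ≥0}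
    (hc : ∀ i x y, (∀ j, j ≠ i → x j = y j) → f x - f y ≤ c i) :
    HasSubgaussianMGF (fun x => f x - ∫ z, f z ∂Measure.pi P) (∑ i, (c i / 2) ^ 2)
      (Measure.pi P) := by
  induction n with
  | zero =>
    have (x : Fin 0 → X) : f x - ∫ z, f z ∂Measure.pi P = 0 := by
      simp [Subsingleton.elim _ x]
    simp only [this, Finset.univ_eq_empty, Finset.sum_empty]
    exact .fun_zero
  | succ n ih =>
    set e := MeasurableEquiv.piFinSuccAbove (fun _ : Fin (n + 1) => X) 0 with he
    have hmp : MeasurePreserving e (Measure.pi P) ((P 0).prod (Measure.pi fun j => P j.succ)) :=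
      measurePreserving_piFinSuccAbove P 0
    have hsymm (z : X × (Fin n → X)) : e.symm z = Fin.cons z.1 z.2 := by
      rw [he, show (MeasurableEquiv.piFinSuccAbove (fun _ : Fin (n + 1) => X) 0).symm z =
        Fin.insertNth (α := fun _ => X) 0 z.1 z.2 from rfl, Fin.insertNth_zero']
    have hF : Measurable fun z => f (e.symm z) := hf.comp e.symm.measurable
    have hg : Measurable fun y => ∫ x, f (e.symm (x, y)) ∂P 0 :=
      (hF.stronglyMeasurable.integral_prod_left' (μ := P 0)).measurable
    have hint (y : Fin n → X) : Integrable (fun x => f (e.symm (x, y))) (P 0) :=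
      Integrable.of_bound (hF.comp (by fun_prop)).aestronglyMeasurable M
        (.of_forall fun x => hM _)
    have key := hasSubgaussianMGF_prod (μ := P 0) (ν := Measure.pi fun j => P j.succ) hF
      (fun z => hM _) (c₁ := (c 0 / 2) ^ 2) (c₂ := ∑ i : Fin n, (c i.succ / 2) ^ 2)
      (fun y => ?_) ?_
    · have hE : ∫ z, f (e.symm z) ∂((P 0).prod (Measure.pi fun j => P j.succ))
          = ∫ z, f z ∂Measure.pi P := by
        rw [← hmp.integral_comp' (fun z => f (e.symm z))]
        simp
      rw [hE, ← hmp.map_eq] at key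
      have := HasSubgaussianMGF.of_map e.measurable.aemeasurable key
      rw [Fin.sum_univ_succ]
      simpa [Function.comp_def] using this
    · refine hasSubgaussianMGF_of_oscillation_le (hF.comp (by fun_prop)) (fun x => hM _)
        fun x x' => ?_
      refine hc 0 _ _ fun j hj => ?_
      obtain ⟨i, rfl⟩ := Fin.exists_succ_eq.2 hj
      simp [hsymm]
    · refine ih (fun j => P j.succ) hg (fun y => ?_) fun i y y' hy => ?_
      · simpa using norm_integral_le_of_norm_le_const (μ := P 0)
          (f := fun x => f (e.symm (x, y))) (C := M) (.of_forall fun x => hM _)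
      · rw [← integral_sub (hint y) (hint y')]
        refine (integral_mono ((hint y).sub (hint y')) (integrable_const (c i.succ : ℝ))
          fun x => ?_).trans_eq (by simp)
        refine hc i.succ _ _ fun j hj => ?_
        simp only [hsymm]
        cases j using Fin.cases with
        | zero => simp
        | succ j => simpa using hy j fun h => hj (by rw [h])

end BoundedDifferences

/-! ### A discrete transport plan that is good at every scale -/

section MultiscaleTransport

variable {A B : Type*} [Fintype A] [Fintype B]

/-- Transport as much mass as possible within each cell. In every cell, one of the two measures is
used up. -/
theorem exists_cellwise_transport {κ : Type*} [DecidableEq κ] {a : A → ℝ} {b : B → ℝ}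
    (ha : ∀ i, 0 ≤ a i) (hb : ∀ j, 0 ≤ b j) (α : A → κ) (β : B → κ) :
    ∃ r : A → B → ℝ, (∀ i j, 0 ≤ r i j) ∧ (∀ i j, α i ≠ β j → r i j = 0) ∧
      (∀ i, ∑ j, r i j ≤ a i) ∧ (∀ j, ∑ i, r i j ≤ b j) ∧
      ∀ F, (∀ i, α i = F → ∑ j, r i j = a i) ∨ (∀ j, β j = F → ∑ i, r i j = b j) := by
  set u : κ → ℝ := fun F => ∑ i with α i = F, a i with hu
  set v : κ → ℝ := fun F => ∑ j with β j = F, b j with hv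
  have hu0 (F) : 0 ≤ u F := Finset.sum_nonneg fun i _ => ha i
  have hv0 (F) : 0 ≤ v F := Finset.sum_nonneg fun j _ => hb j
  have hau (i) : a i ≤ u (α i) :=
    Finset.single_le_sum (f := a) (fun i _ => ha i) (by simp)
  have hbv (j) : b j ≤ v (β j) :=
    Finset.single_le_sum (f := b) (fun i _ => hb i) (by simp)
  have hM (F) : 0 ≤ max (u F) (v F) := le_max_of_le_left (hu0 F)
  -- Within a cell of masses `u` and `v`, the amount `min u v` is spread proportionally to
  -- `a i * b j`, which gives the density `min u v / (u * v) = 1 / max u v`.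
  set r : A → B → ℝ := fun i j =>
    if α i = β j then a i * b j / max (u (α i)) (v (α i)) else 0 with hr
  have hrow (i) : ∑ j, r i j = a i * (v (α i) / max (u (α i)) (v (α i))) := by
    simp only [hr, hv, Finset.sum_filter, Finset.mul_sum, Finset.sum_div, mul_div_assoc]
    refine Finset.sum_congr rfl fun j _ => ?_
    by_cases h : α i = β j
    · simp [h]
    · simp [h, Ne.symm h]
  have hcol (j) : ∑ i, r i j = b j * (u (β j) / max (u (β j)) (v (β j))) := by
    simp only [hr, hu, Finset.sum_filter, Finset.mul_sum, Finset.sum_div, mul_div_assoc]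
    refine Finset.sum_congr rfl fun i _ => ?_
    by_cases h : α i = β j
    · simp only [h, if_true]; ring
    · simp [h]
  refine ⟨r, fun i j => ?_, fun i j h => by simp [hr, h], fun i => ?_, fun j => ?_, fun F => ?_⟩
  · simp only [hr]
    split_ifs
    · exact div_nonneg (mul_nonneg (ha i) (hb j)) (hM _)
    · rfl
  · rw [hrow]
    exact mul_le_of_le_one_right (ha i) (div_le_one_of_le₀ (le_max_right _ _) (hM _))
  · rw [hcol]
    exact mul_le_of_le_one_right (hb j) (div_le_one_of_le₀ (le_max_left _ _) (hM _))
  · rcases le_total (u F) (v F) with h | h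
    · left
      rintro i rfl
      rw [hrow, max_eq_right h]
      rcases (hv0 (α i)).eq_or_lt with h0 | h0
      · have : a i = 0 := le_antisymm ((hau i).trans (h.trans h0.ge)) (ha i)
        simp [this]
      · rw [div_self h0.ne', mul_one]
    · right
      rintro j rfl
      rw [hcol, max_eq_left h]
      rcases (hu0 (β j)).eq_or_lt with h0 | h0
      · have : b j = 0 := le_antisymm ((hbv j).trans (h.trans h0.ge)) (hb j)
        simp [this]
      · rw [div_self h0.ne', mul_one]

theorem exists_product_transport {a : A → ℝ} {b : B → ℝ} (ha : ∀ i, 0 ≤ a i) (hb : ∀ j, 0 ≤ b j)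
    (hab : ∑ i, a i = ∑ j, b j) :
    ∃ r : A → B → ℝ, (∀ i j, 0 ≤ r i j) ∧ (∀ i, ∑ j, r i j = a i) ∧ (∀ j, ∑ i, r i j = b j) := by
  obtain ⟨r, h0, -, hr, hc, h⟩ := exists_cellwise_transport ha hb (fun _ => ()) (fun _ => ())
  have htot : ∑ i, ∑ j, r i j = ∑ j, ∑ i, r i j := Finset.sum_comm
  refine ⟨r, h0, ?_⟩
  rcases h () with h | h
  · refine ⟨fun i => h i rfl, fun j => ?_⟩
    refine (Finset.sum_eq_sum_iff_of_le fun j _ => hc j).1 ?_ j (Finset.mem_univ j)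
    rw [← htot, ← hab]
    exact Finset.sum_congr rfl fun i _ => h i rfl
  · refine ⟨fun i => ?_, fun j => h j rfl⟩
    refine (Finset.sum_eq_sum_iff_of_le fun i _ => hr i).1 ?_ i (Finset.mem_univ i)
    rw [htot, hab]
    exact Finset.sum_congr rfl fun j _ => h j rfl

/-- For nested partitions there is one transport plan that serves all of them at once: the mass
it moves between different cells of a partition is at most the total discrepancy of the masses of
the cells. The plan is built from the finest
partition upwards: first match within its cells, then treat what is left by the coarser
partitions. The nesting hypothesis relates a source and a target point only, as no other pairs
occur. -/
theorem exists_multiscale_transport {ι : ℕ → Type*} [∀ n, Fintype (ι n)]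
    [∀ n, DecidableEq (ι n)] {α : ∀ n, A → ι n} {β : ∀ n, B → ι n}
    (hnest : ∀ n i j, α (n + 1) i = β (n + 1) j → α n i = β n j) (L : ℕ) {a : A → ℝ} {b : B → ℝ}
    (ha : ∀ i, 0 ≤ a i) (hb : ∀ j, 0 ≤ b j) (hab : ∑ i, a i = ∑ j, b j) :
    ∃ r : A → B → ℝ, (∀ i j, 0 ≤ r i j) ∧ (∀ i, ∑ j, r i j = a i) ∧ (∀ j, ∑ i, r i j = b j) ∧
      ∀ n < L, (∑ i, ∑ j, if α n i = β n j then 0 else r i j) ≤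
        ∑ F, |(∑ i with α n i = F, a i) - ∑ j with β n j = F, b j| := by
  have hnest' : ∀ {k n}, n ≤ k → ∀ i j, α k i = β k j → α n i = β n j := by
    intro k n hn i j
    induction k, hn using Nat.le_induction with
    | base => exact id
    | succ k _ ih => exact fun h => ih (hnest k i j h)
  induction L generalizing a b with
  | zero =>
    obtain ⟨r, h0, hr, hc⟩ := exists_product_transport ha hb hab
    exact ⟨r, h0, hr, hc, by simp⟩
  | succ L ih =>
    obtain ⟨s, hs0, hs, hsr, hsc, hsF⟩ := exists_cellwise_transport ha hb (α L) (β L)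
    set a' : A → ℝ := fun i => a i - ∑ j, s i j with ha'
    set b' : B → ℝ := fun j => b j - ∑ i, s i j with hb'
    have ha0 : ∀ i, 0 ≤ a' i := fun i => sub_nonneg.2 (hsr i)
    have hb0 : ∀ j, 0 ≤ b' j := fun j => sub_nonneg.2 (hsc j)
    have hab' : ∑ i, a' i = ∑ j, b' j := by
      simp only [ha', hb', Finset.sum_sub_distrib, hab]
      rw [Finset.sum_comm]
    obtain ⟨r, hr0, hrr, hrc, hr⟩ := ih ha0 hb0 hab'
    -- Matching within cells of level `L` does not alter the discrepancies at coarser levels.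
    have hdiff : ∀ n ≤ L, ∀ F, (∑ i with α n i = F, a' i) - ∑ j with β n j = F, b' j =
        (∑ i with α n i = F, a i) - ∑ j with β n j = F, b j := by
      intro n hn F
      have : ∑ i with α n i = F, ∑ j, s i j = ∑ j with β n j = F, ∑ i, s i j := by
        simp only [Finset.sum_filter]
        have h1 : ∀ i, (if α n i = F then ∑ j, s i j else 0) =
            ∑ j, if α n i = F then s i j else 0 := fun i => by split_ifs <;> simp
        have h2 : ∀ j, (if β n j = F then ∑ i, s i j else 0) =
            ∑ i, if β n j = F then s i j else 0 := fun j => by split_ifs <;> simp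
        simp only [h1, h2]
        rw [Finset.sum_comm]
        refine Finset.sum_congr rfl fun j _ => Finset.sum_congr rfl fun i _ => ?_
        by_cases h : α L i = β L j
        · rw [hnest' hn i j h]
        · simp [hs i j h]
      simp only [ha', hb', Finset.sum_sub_distrib, this]
      ring
    refine ⟨fun i j => s i j + r i j, fun i j => add_nonneg (hs0 i j) (hr0 i j), fun i => ?_,
      fun j => ?_, fun n hn => ?_⟩
    · rw [Finset.sum_add_distrib, hrr]; simp [ha']
    · rw [Finset.sum_add_distrib, hrc]; simp [hb']
    have hn' : n ≤ L := Nat.lt_succ_iff.1 hn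
    have hle : (∑ i, ∑ j, if α n i = β n j then 0 else s i j + r i j) =
        ∑ i, ∑ j, if α n i = β n j then 0 else r i j := by
      refine Finset.sum_congr rfl fun i _ => Finset.sum_congr rfl fun j _ => ?_
      split_ifs with h
      · rfl
      · rw [hs i j fun h' => h (hnest' hn' i j h'), zero_add]
    rw [hle]
    simp only [← hdiff n hn']
    rcases hn'.lt_or_eq with h | rfl
    · exact hr n h
    -- At the finest level only the leftover mass leaves its cell. In each cell it consists of
    -- source mass or of target mass only, so that its amount is at most the discrepancy.
    calc (∑ i, ∑ j, if α n i = β n j then 0 else r i j) ≤ ∑ i, ∑ j, r i j := by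
          refine Finset.sum_le_sum fun i _ => Finset.sum_le_sum fun j _ => ?_
          split_ifs
          · exact hr0 i j
          · rfl
      _ = ∑ i, a' i := Finset.sum_congr rfl fun i _ => hrr i
      _ = ∑ F, ∑ i with α n i = F, a' i := by
          rw [Finset.sum_fiberwise]
      _ ≤ _ := by
          refine Finset.sum_le_sum fun F _ => ?_
          rcases hsF F with h | h
          · rw [Finset.sum_eq_zero fun i hi => by
              simp [ha', h i (Finset.mem_filter.1 hi).2]]
            exact abs_nonneg _
          · rw [Finset.sum_eq_zero (s := Finset.univ.filter fun j => β n j = F) fun j hj => by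
              simp [hb', h j (Finset.mem_filter.1 hj).2], sub_zero]
            exact le_abs_self _

end MultiscaleTransport

/-! ### The cost of transporting a weighted sample to a measure -/

section SemidiscreteCost

section MassSplits

variable {E : Type*} [MeasurableSpace E] {T : ℕ}

/-- The ways of splitting the measure `ν` into pieces `R t` of mass `w t`. Assigning the piece
`R t` to the atom `x t` amounts to a coupling of `∑ t, w t • δ_{x t}` with `ν`. -/
def massSplits (w : Fin T → ℝ) (ν : Measure E) : Set (Fin T → Measure E) :=
  {R | (∀ t, R t Set.univ = ENNReal.ofReal (w t)) ∧ ∑ t, R t = ν}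

theorem isFiniteMeasure_of_mem_massSplits {w : Fin T → ℝ} {ν : Measure E}
    {R : Fin T → Measure E} (hR : R ∈ massSplits w ν) (t : Fin T) : IsFiniteMeasure (R t) :=
  ⟨by rw [hR.1 t]; exact ENNReal.ofReal_lt_top⟩

theorem measureReal_univ_of_mem_massSplits {w : Fin T → ℝ} {ν : Measure E} (hw : ∀ t, 0 ≤ w t)
    {R : Fin T → Measure E} (hR : R ∈ massSplits w ν) (t : Fin T) : (R t).real Set.univ = w t := by
  rw [measureReal_def, hR.1 t, ENNReal.toReal_ofReal (hw t)]

theorem absolutelyContinuous_of_mem_massSplits {w : Fin T → ℝ} {ν : Measure E}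
    {R : Fin T → Measure E} (hR : R ∈ massSplits w ν) (t : Fin T) : R t ≪ ν := by
  intro s hs
  rw [← hR.2, Measure.finsetSum_apply, Finset.sum_eq_zero_iff] at hs
  exact hs t (Finset.mem_univ t)

theorem nonempty_massSplits {w : Fin T → ℝ} (hw : w ∈ stdSimplex ℝ (Fin T)) (ν : Measure E)
    [IsProbabilityMeasure ν] : (massSplits w ν).Nonempty := by
  refine ⟨fun t => ENNReal.ofReal (w t) • ν, fun t => by simp, ?_⟩
  rw [← Finset.sum_smul, ← ENNReal.ofReal_sum_of_nonneg fun t _ => hw.1 t, hw.2,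
    ENNReal.ofReal_one, one_smul]

end MassSplits

section Definitions

variable {E : Type*} [NormedAddCommGroup E] {T : ℕ}

/-- The transport cost `‖x - y‖ ^ p`, truncated at the distance `D`. On a set of diameter at most
`D` the truncation is void; elsewhere it keeps the cost bounded, so that the bounded differences
property holds at all points of the space. -/
noncomputable def truncCost (p D : ℝ) (x y : E) : ℝ := min ‖x - y‖ D ^ p

/-- The optimal truncated cost of transporting `∑ t, w t • δ_{x t}` to `ν`. -/
noncomputable def semidiscreteCost [MeasurableSpace E] (p D : ℝ) (w : Fin T → ℝ) (ν : Measure E)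
    (x : Fin T → E) : ℝ :=
  ⨅ R : massSplits w ν, ∑ t, ∫ y, truncCost p D (x t) y ∂(R.1 t)

end Definitions

variable {E : Type*} [NormedAddCommGroup E] {T : ℕ} {p D : ℝ}

theorem truncCost_nonneg (hD : 0 ≤ D) (x y : E) : 0 ≤ truncCost p D x y :=
  Real.rpow_nonneg (le_min (norm_nonneg _) hD) _

theorem truncCost_le (hp : 0 < p) (hD : 0 ≤ D) (x y : E) : truncCost p D x y ≤ D ^ p :=
  Real.rpow_le_rpow (le_min (norm_nonneg _) hD) (min_le_right _ _) hp.le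

theorem continuous_truncCost (hp : 0 < p) :
    Continuous fun z : E × E => truncCost p D z.1 z.2 := by
  unfold truncCost
  exact ((continuous_fst.sub continuous_snd).norm.min continuous_const).rpow_const
    fun _ => .inr hp.le

variable [MeasurableSpace E]

theorem semidiscreteCost_nonneg (hD : 0 ≤ D) (w : Fin T → ℝ) (ν : Measure E) (x : Fin T → E) :
    0 ≤ semidiscreteCost p D w ν x :=
  Real.iInf_nonneg fun _ => Finset.sum_nonneg fun _ _ =>
    integral_nonneg fun _ => truncCost_nonneg hD _ _

theorem bddBelow_range_splitCost (hD : 0 ≤ D) (w : Fin T → ℝ) (ν : Measure E) (x : Fin T → E) :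
    BddBelow (Set.range fun R : massSplits w ν => ∑ t, ∫ y, truncCost p D (x t) y ∂(R.1 t)) :=
  ⟨0, by
    rintro _ ⟨R, rfl⟩
    exact Finset.sum_nonneg fun _ _ => integral_nonneg fun _ => truncCost_nonneg hD _ _⟩

theorem semidiscreteCost_le_of_mem (hD : 0 ≤ D) {w : Fin T → ℝ} {ν : Measure E}
    {R : Fin T → Measure E} (hR : R ∈ massSplits w ν) (x : Fin T → E) :
    semidiscreteCost p D w ν x ≤ ∑ t, ∫ y, truncCost p D (x t) y ∂(R t) :=
  ciInf_le (bddBelow_range_splitCost hD w ν x) ⟨R, hR⟩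

variable [BorelSpace E]

theorem integrable_truncCost (hp : 0 < p) (hD : 0 ≤ D) (x : E) (ν : Measure E)
    [IsFiniteMeasure ν] : Integrable (truncCost p D x) ν := by
  have : Continuous (truncCost p D x) :=
    (continuous_truncCost (D := D) hp).comp (Continuous.prodMk_right x)
  refine Integrable.of_bound this.aestronglyMeasurable (D ^ p) (.of_forall fun y => ?_)
  rw [Real.norm_of_nonneg (truncCost_nonneg hD _ _)]
  exact truncCost_le hp hD _ _

theorem integral_truncCost_le (hp : 0 < p) (hD : 0 ≤ D) {w : Fin T → ℝ} {ν : Measure E}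
    (hw : ∀ t, 0 ≤ w t) {R : Fin T → Measure E} (hR : R ∈ massSplits w ν) (x : E) (t : Fin T) :
    ∫ y, truncCost p D x y ∂(R t) ≤ w t * D ^ p := by
  have := isFiniteMeasure_of_mem_massSplits hR t
  refine (integral_mono (integrable_truncCost hp hD _ _) (integrable_const (D ^ p))
    fun y => truncCost_le hp hD _ _).trans_eq ?_
  rw [integral_const, measureReal_univ_of_mem_massSplits hw hR, smul_eq_mul]

theorem semidiscreteCost_le (hp : 0 < p) (hD : 0 ≤ D) {w : Fin T → ℝ}
    (hw : w ∈ stdSimplex ℝ (Fin T)) (ν : Measure E) [IsProbabilityMeasure ν] (x : Fin T → E) :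
    semidiscreteCost p D w ν x ≤ D ^ p := by
  obtain ⟨R, hR⟩ := nonempty_massSplits hw ν
  refine (semidiscreteCost_le_of_mem hD hR x).trans ?_
  refine (Finset.sum_le_sum fun t _ => integral_truncCost_le hp hD hw.1 hR (x t) t).trans_eq ?_
  rw [← Finset.sum_mul, hw.2, one_mul]

/-- A splitting for `y` also serves for `x`; only the piece at the atom that differs changes its
cost. -/
theorem semidiscreteCost_sub_le (hp : 0 < p) (hD : 0 ≤ D) {w : Fin T → ℝ}
    (hw : w ∈ stdSimplex ℝ (Fin T)) (ν : Measure E) [IsProbabilityMeasure ν] {x y : Fin T → E}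
    {i : Fin T} (hxy : ∀ j, j ≠ i → x j = y j) :
    semidiscreteCost p D w ν x - semidiscreteCost p D w ν y ≤ w i * D ^ p := by
  have : Nonempty (massSplits w ν) := (nonempty_massSplits hw ν).to_subtype
  rw [sub_le_comm]
  refine le_ciInf fun R => ?_
  rw [sub_le_iff_le_add]
  refine (semidiscreteCost_le_of_mem hD R.2 x).trans ?_
  rw [← Finset.add_sum_erase _ _ (Finset.mem_univ i),
    ← Finset.add_sum_erase _ (fun t => ∫ z, truncCost p D (y t) z ∂(R.1 t)) (Finset.mem_univ i)]
  have h1 := integral_truncCost_le hp hD hw.1 R.2 (x i) i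
  have h2 : 0 ≤ ∫ z, truncCost p D (y i) z ∂(R.1 i) :=
    integral_nonneg fun _ => truncCost_nonneg hD _ _
  have h3 : ∑ t ∈ Finset.univ.erase i, ∫ z, truncCost p D (x t) z ∂(R.1 t) =
      ∑ t ∈ Finset.univ.erase i, ∫ z, truncCost p D (y t) z ∂(R.1 t) :=
    Finset.sum_congr rfl fun t ht => by rw [hxy t (Finset.ne_of_mem_erase ht)]
  linarith

variable [SecondCountableTopology E]

/-- Each fixed splitting has a cost that is continuous in `x`, so the infimum over the uncountable
set of splittings is still upper semicontinuous. -/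
theorem measurable_semidiscreteCost (hp : 0 < p) (hD : 0 ≤ D) (w : Fin T → ℝ) (ν : Measure E) :
    Measurable (semidiscreteCost p D w ν) := by
  refine UpperSemicontinuous.measurable ?_
  refine upperSemicontinuous_ciInf (bddBelow_range_splitCost hD w ν) fun R => ?_
  refine Continuous.upperSemicontinuous (continuous_finsetSum _ fun t _ => ?_)
  have := isFiniteMeasure_of_mem_massSplits R.2 t
  have hc : Continuous fun z : E => ∫ y, truncCost p D z y ∂(R.1 t) := by
    refine continuous_of_dominated (bound := fun _ => D ^ p)
      (fun z => (integrable_truncCost hp hD z _).aestronglyMeasurable)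
      (fun z => .of_forall fun y => ?_) (integrable_const _) (.of_forall fun y => ?_)
    · rw [Real.norm_of_nonneg (truncCost_nonneg hD _ _)]
      exact truncCost_le hp hD _ _
    · exact (continuous_truncCost (D := D) hp).comp (Continuous.prodMk_left y)
  exact hc.comp (continuous_apply t)

theorem wassersteinDist_weightedEmpirical_le (hp : 0 < p) (hD : 0 ≤ D) {w : Fin T → ℝ}
    {ν : Measure E} {R : Fin T → Measure E} (hR : R ∈ massSplits w ν) {x : Fin T → E}
    (hx : ∀ t, ∀ᵐ y ∂ν, ‖x t - y‖ ≤ D) :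
    wassersteinDist p (weightedEmpirical w x) ν ≤
      ENNReal.ofReal ((∑ t, ∫ y, truncCost p D (x t) y ∂(R t)) ^ (1 / p)) := by
  have hm (t : Fin T) : Measurable fun y : E => (x t, y) := by fun_prop
  have hmap (f : E × E → E) (hf : Measurable f) :
      (∑ t, (R t).map fun y => (x t, y)).map f = ∑ t, (R t).map fun y => f (x t, y) := by
    ext s hs
    have (t : Fin T) : ((R t).map fun y => f (x t, y)) s =
        ((R t).map fun y => (x t, y)) (f ⁻¹' s) := by
      rw [Measure.map_apply (hm t) (hf hs)]
      exact Measure.map_apply (hf.comp (hm t)) hs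
    simp only [Measure.map_apply hf hs, Measure.finsetSum_apply, this]
  rw [← ENNReal.ofReal_rpow_of_nonneg (Finset.sum_nonneg fun _ _ =>
    integral_nonneg fun _ => truncCost_nonneg hD _ _) (by positivity)]
  refine wassersteinDist_le hp (γ := ∑ t, (R t).map fun y => (x t, y)) ⟨?_, ?_⟩ ?_
  · rw [hmap _ measurable_fst]
    simp only [Measure.map_const, hR.1, weightedEmpirical]
  · rw [hmap _ measurable_snd]
    simp only [Measure.map_id', hR.2]
  · rw [lintegral_finsetSum_measure, ENNReal.ofReal_sum_of_nonneg fun _ _ =>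
      integral_nonneg fun _ => truncCost_nonneg hD _ _]
    refine Finset.sum_le_sum fun t _ => ?_
    have := isFiniteMeasure_of_mem_massSplits hR t
    rw [lintegral_map (by fun_prop) (hm t), ofReal_integral_eq_lintegral_ofReal
      (integrable_truncCost hp hD _ _) (.of_forall fun y => truncCost_nonneg hD _ _)]
    refine lintegral_mono_ae ?_
    filter_upwards [(absolutelyContinuous_of_mem_massSplits hR t).ae_le (hx t)] with y hy
    rw [truncCost, min_eq_left hy, ← ENNReal.ofReal_rpow_of_nonneg (norm_nonneg _) hp.le,
      ofReal_norm]

/-- The infimum in `semidiscreteCost` need not be attained, whence the strict inequalities. -/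
theorem wassersteinDist_weightedEmpirical_lt (hp : 0 < p) (hD : 0 ≤ D) {w : Fin T → ℝ}
    (hw : w ∈ stdSimplex ℝ (Fin T)) {ν : Measure E} [IsProbabilityMeasure ν] {x : Fin T → E}
    (hx : ∀ t, ∀ᵐ y ∂ν, ‖x t - y‖ ≤ D) {c : ℝ} (hc : 0 < c)
    (h : semidiscreteCost p D w ν x < c ^ p) :
    wassersteinDist p (weightedEmpirical w x) ν < ENNReal.ofReal c := by
  have : Nonempty (massSplits w ν) := (nonempty_massSplits hw ν).to_subtype
  obtain ⟨R, hR⟩ := exists_lt_of_ciInf_lt h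
  refine (wassersteinDist_weightedEmpirical_le hp hD R.2 hx).trans_lt ?_
  rw [ENNReal.ofReal_lt_ofReal_iff hc]
  have h0 : 0 ≤ ∑ t, ∫ y, truncCost p D (x t) y ∂(R.1 t) :=
    Finset.sum_nonneg fun _ _ => integral_nonneg fun _ => truncCost_nonneg hD _ _
  have := Real.rpow_lt_rpow h0 hR (z := 1 / p) (by positivity)
  rwa [← Real.rpow_mul hc.le, mul_one_div_cancel hp.ne', Real.rpow_one] at this

end SemidiscreteCost

/-! ### The semidiscrete cost is controlled by discrepancies on cells -/

section MultiscaleBound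

/-- The cost `c` of moving a point is charged to the levels at which its origin and its
destination lie in different cells; `S n` says that they share the cell of level `n`. Nestedness
is not needed: the last level before the first separation already pays. -/
theorem le_multiscale_sum {S : ℕ → Prop} [DecidablePred S] {η : ℕ → ℝ} {c : ℝ} (hη : ∀ n, 0 ≤ η n)
    (h0 : S 0) (hc : ∀ n, S n → c ≤ η n) (L : ℕ) :
    c ≤ η L + ∑ n ∈ Finset.range L, η n * if S (n + 1) then 0 else 1 := by
  have hpos (L : ℕ) : 0 ≤ ∑ n ∈ Finset.range L, η n * if S (n + 1) then 0 else 1 :=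
    Finset.sum_nonneg fun n _ => mul_nonneg (hη n) (by split_ifs <;> norm_num)
  induction L with
  | zero => simpa using hc 0 h0
  | succ L ih =>
    by_cases h : S (L + 1)
    · linarith [hc _ h, hpos (L + 1)]
    · rw [Finset.sum_range_succ, if_neg h]
      linarith [hη (L + 1)]

/-- A discrete transport plan from the atoms to the cells becomes a splitting of `ν` when the mass
received by a cell is distributed like `ν` on that cell. -/
theorem exists_massSplit {E κ : Type*} [MeasurableSpace E] [Fintype κ] [DecidableEq κ] {T : ℕ}
    {w : Fin T → ℝ} {ν : Measure E} [IsProbabilityMeasure ν] {K : E → κ}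
    (hK : ∀ G, MeasurableSet (K ⁻¹' {G})) {r : Fin T → κ → ℝ} (hr : ∀ t G, 0 ≤ r t G)
    (hrow : ∀ t, ∑ G, r t G = w t) (hcol : ∀ G, ∑ t, r t G = ν.real (K ⁻¹' {G})) :
    (fun t => ∑ G, ENNReal.ofReal (r t G) • ν[|K ⁻¹' {G}]) ∈ massSplits w ν := by
  have hr0 (t G) (h : ν (K ⁻¹' {G}) = 0) : r t G = 0 := by
    have := hcol G
    rw [measureReal_def, h, ENNReal.toReal_zero,
      Finset.sum_eq_zero_iff_of_nonneg fun t _ => hr t G] at this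
    exact this t (Finset.mem_univ t)
  refine ⟨fun t => ?_, ?_⟩
  · rw [← hrow t, ENNReal.ofReal_sum_of_nonneg fun G _ => hr t G]
    simp only [Measure.finsetSum_apply, Measure.smul_apply, smul_eq_mul]
    refine Finset.sum_congr rfl fun G _ => ?_
    by_cases h : ν (K ⁻¹' {G}) = 0
    · simp [hr0 t G h]
    · have := cond_isProbabilityMeasure h
      simp
  -- Summed over the atoms, the pieces on the cell `G` make up the restriction of `ν` to `G`.
  · rw [Finset.sum_comm]
    have h1 (G) : ∑ t, ENNReal.ofReal (r t G) • ν[|K ⁻¹' {G}] = ν.restrict (K ⁻¹' {G}) := by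
      rw [← Finset.sum_smul, ← ENNReal.ofReal_sum_of_nonneg fun t _ => hr t G, hcol,
        ofReal_measureReal, ProbabilityTheory.cond, smul_smul]
      by_cases h : ν (K ⁻¹' {G}) = 0
      · rw [Measure.restrict_eq_zero.2 h, smul_zero]
      · rw [ENNReal.mul_inv_cancel h (measure_ne_top _ _), one_smul]
    simp only [h1]
    ext s hs
    rw [Measure.finsetSum_apply]
    simp only [Measure.restrict_apply hs]
    have := sum_measure_preimage_singleton (μ := ν.restrict s) Finset.univ
      (f := K) (fun G _ => hK G)
    simpa [Measure.restrict_apply (hK _), Set.inter_comm] using this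

variable {E : Type*} [NormedAddCommGroup E] [MeasurableSpace E] [BorelSpace E] {T : ℕ} {p D : ℝ}

/-- If points of a common cell of level `n` are at cost at most `η n`, then the transport cost is
bounded by a weighted sum of the discrepancies between `∑ t, w t • δ_{x t}` and `ν` on the cells of
all levels up to `L`. -/
theorem semidiscreteCost_le_multiscale (hp : 0 < p) (hD : 0 ≤ D) {w : Fin T → ℝ}
    (hw : w ∈ stdSimplex ℝ (Fin T)) {ν : Measure E} [IsProbabilityMeasure ν]
    {ι : ℕ → Type*} [∀ n, Fintype (ι n)] [∀ n, DecidableEq (ι n)] [Subsingleton (ι 0)]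
    {K : ∀ n, E → ι n} (hK : ∀ n F, MeasurableSet (K n ⁻¹' {F}))
    (hnest : ∀ n x y, K (n + 1) x = K (n + 1) y → K n x = K n y)
    {η : ℕ → ℝ} (hη0 : ∀ n, 0 ≤ η n) {x : Fin T → E}
    (hη : ∀ᵐ y ∂ν, ∀ t n, K n (x t) = K n y → truncCost p D (x t) y ≤ η n) (L : ℕ) :
    semidiscreteCost p D w ν x ≤ η L + ∑ n ∈ Finset.range L, η n *
      ∑ F, |(∑ t with K (n + 1) (x t) = F, w t) - ν.real (K (n + 1) ⁻¹' {F})| := by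
  classical
  have hnest' : ∀ {k n}, n ≤ k → ∀ x y, K k x = K k y → K n x = K n y := by
    intro k n hn x y
    induction k, hn using Nat.le_induction with
    | base => exact id
    | succ k _ ih => exact fun h => ih (hnest k x y h)
  -- A representative of each finest cell; by nestedness it determines the coarser cells. The
  -- value `0` at an index without points is immaterial, as such a cell is null.
  set rep : ι L → E := fun G => if h : ∃ x, K L x = G then h.choose else 0 with hrep
  have hrep' (y : E) : K L (rep (K L y)) = K L y := by
    have h : ∃ x, K L x = K L y := ⟨y, rfl⟩
    simp only [hrep, dif_pos h]
    exact h.choose_spec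
  have hmass (n : ℕ) (hn : n ≤ L) (F : ι n) :
      ∑ G with K n (rep G) = F, ν.real (K L ⁻¹' {G}) = ν.real (K n ⁻¹' {F}) := by
    rw [sum_measureReal_preimage_singleton _ fun G _ => hK L G]
    congr 1
    ext y
    simp [hnest' hn _ _ (hrep' y)]
  have htot : ∑ t, w t = ∑ G, ν.real (K L ⁻¹' {G}) := by
    rw [sum_measureReal_preimage_singleton _ fun G _ => hK L G, hw.2]
    simp
  obtain ⟨r, hr0, hrow, hcol, hr⟩ := exists_multiscale_transport
    (α := fun n t => K n (x t)) (β := fun n G => K n (rep G))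
    (fun n t G => hnest n _ _) (L + 1) hw.1 (fun G => measureReal_nonneg) htot
  have hR := exists_massSplit (hK L) hr0 hrow hcol
  refine (semidiscreteCost_le_of_mem hD hR x).trans ?_
  have hcell (t : Fin T) (G : ι L) : r t G * ∫ y, truncCost p D (x t) y ∂ν[|K L ⁻¹' {G}] ≤
      r t G * (η L + ∑ n ∈ Finset.range L,
        η n * if K (n + 1) (x t) = K (n + 1) (rep G) then 0 else 1) := by
    by_cases h : ν (K L ⁻¹' {G}) = 0
    · have : r t G = 0 := by
        have := hcol G
        rw [measureReal_def, h, ENNReal.toReal_zero,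
          Finset.sum_eq_zero_iff_of_nonneg fun t _ => hr0 t G] at this
        exact this t (Finset.mem_univ t)
      simp [this]
    · have := cond_isProbabilityMeasure h
      refine mul_le_mul_of_nonneg_left ?_ (hr0 t G)
      set C := η L + ∑ n ∈ Finset.range L,
        η n * if K (n + 1) (x t) = K (n + 1) (rep G) then 0 else 1 with hC
      have hle : ∀ᵐ y ∂ν[|K L ⁻¹' {G}], truncCost p D (x t) y ≤ C := by
        filter_upwards [cond_absolutelyContinuous.ae_le hη, ae_cond_mem (hK L G)] with y hy hyG
        obtain rfl : K L y = G := hyG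
        refine (le_multiscale_sum (S := fun n => K n (x t) = K n y) hη0
          (Subsingleton.elim _ _) (hy t) L).trans_eq ?_
        rw [hC]
        congr 1
        refine Finset.sum_congr rfl fun n hn => ?_
        rw [hnest' (Finset.mem_range.1 hn) _ _ (hrep' y)]
      simpa using integral_mono_ae (integrable_truncCost hp hD _ _) (integrable_const C) hle
  have hint (t : Fin T) : ∫ y, truncCost p D (x t) y
      ∂(∑ G, ENNReal.ofReal (r t G) • ν[|K L ⁻¹' {G}]) =
      ∑ G, r t G * ∫ y, truncCost p D (x t) y ∂ν[|K L ⁻¹' {G}] := by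
    have hfin (G : ι L) : IsFiniteMeasure (ENNReal.ofReal (r t G) • ν[|K L ⁻¹' {G}]) :=
      Measure.smul_finite _ ENNReal.ofReal_ne_top
    rw [integral_finsetSum_measure fun G _ => integrable_truncCost hp hD _ _]
    simp [integral_smul_measure, ENNReal.toReal_ofReal (hr0 t _)]
  calc _ = ∑ t, ∑ G, r t G * ∫ y, truncCost p D (x t) y ∂ν[|K L ⁻¹' {G}] :=
        Finset.sum_congr rfl fun t _ => hint t
    _ ≤ ∑ t, ∑ G, r t G * (η L + ∑ n ∈ Finset.range L,
        η n * if K (n + 1) (x t) = K (n + 1) (rep G) then 0 else 1) :=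
        Finset.sum_le_sum fun t _ => Finset.sum_le_sum fun G _ => hcell t G
    _ = η L + ∑ n ∈ Finset.range L, η n *
        ∑ t, ∑ G, if K (n + 1) (x t) = K (n + 1) (rep G) then 0 else r t G := by
        simp only [mul_add, Finset.sum_add_distrib, ← Finset.sum_mul, hrow, hw.2, one_mul]
        congr 1
        simp only [Finset.mul_sum]
        rw [Finset.sum_comm (s := Finset.range L)]
        refine Finset.sum_congr rfl fun t _ => ?_
        rw [Finset.sum_comm (s := Finset.range L)]
        refine Finset.sum_congr rfl fun G _ => Finset.sum_congr rfl fun n _ => ?_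
        split_ifs <;> ring
    _ ≤ _ := by
        gcongr with n hn
        · exact hη0 n
        · refine (hr (n + 1) (by simpa using hn)).trans_eq ?_
          refine Finset.sum_congr rfl fun F _ => ?_
          rw [hmass (n + 1) (by simpa using hn)]

end MultiscaleBound

/-! ### Optimising the number of scales -/

section Rate

/-- The sum over the scales is of order `N ^ (-q)` when the finest level has about `N` cells. Since
`q ≤ p / m`, the `n`-th term is at most a multiple of `N ^ (-1 / 2) * θ ^ n` with
`θ = 2 ^ (m * (1 / 2 - q)) > 1`, so that the geometric sum is governed by its last term; this
covers `p > m / 2`, `p = m / 2` and `p < m / 2` alike. -/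
theorem exists_level_sum_le {N p q : ℝ} {m : ℕ} (hN : 1 ≤ N) (hm : 0 < m) (hq0 : 0 < q)
    (hq : q < 1 / 2) (hqp : q ≤ p / m) :
    ∃ L : ℕ, ((2 : ℝ) ^ (-p)) ^ L + ∑ n ∈ Finset.range L, ((2 : ℝ) ^ (-p)) ^ n *
        √(((2 : ℝ) ^ m) ^ (n + 1) / N) ≤
      (1 + √((2 : ℝ) ^ m) * (((2 : ℝ) ^ m) ^ (1 / 2 - q) / (((2 : ℝ) ^ m) ^ (1 / 2 - q) - 1))) *
        N ^ (-q) := by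
  set b : ℝ := (2 : ℝ) ^ m with hb
  have hb1 : 1 < b := one_lt_pow₀ (by norm_num) hm.ne'
  have hb0 : 0 < b := by linarith
  have hN0 : 0 < N := by linarith
  set θ : ℝ := b ^ (1 / 2 - q) with hθ
  have hθ1 : 1 < θ := Real.one_lt_rpow hb1 (by linarith)
  have hex : ∃ L : ℕ, N ≤ b ^ L := by
    obtain ⟨L, hL⟩ := pow_unbounded_of_one_lt N hb1
    exact ⟨L, hL.le⟩
  classical
  -- The first level with at least `N` cells.
  set L := Nat.find hex with hL
  have hNL : N ≤ b ^ L := Nat.find_spec hex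
  have hlt : ∀ n < L, b ^ n < N := fun n hn => not_le.1 (Nat.find_min hex hn)
  have hpow (n : ℕ) (s : ℝ) : (b ^ s) ^ n = (b ^ n) ^ s := by
    rw [← Real.rpow_natCast, ← Real.rpow_natCast, ← Real.rpow_mul hb0.le, ← Real.rpow_mul hb0.le,
      mul_comm]
  have hdecay (n : ℕ) : ((2 : ℝ) ^ (-p)) ^ n ≤ (b ^ n) ^ (-q) := by
    rw [← hpow]
    refine pow_le_pow_left₀ (by positivity) ?_ n
    rw [hb, ← Real.rpow_natCast, ← Real.rpow_mul (by norm_num)]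
    refine Real.rpow_le_rpow_of_exponent_le (by norm_num) ?_
    rw [le_div_iff₀ (by positivity)] at hqp
    linarith
  have hterm (n : ℕ) : ((2 : ℝ) ^ (-p)) ^ n * √(b ^ (n + 1) / N) ≤
      √b * N ^ (-(1 / 2) : ℝ) * θ ^ n := by
    have hbn : 0 < b ^ n := by positivity
    have : √(b ^ (n + 1) / N) = √b * N ^ (-(1 / 2) : ℝ) * (b ^ n) ^ (1 / 2 : ℝ) := by
      rw [Real.sqrt_div (by positivity), pow_succ, Real.sqrt_mul (by positivity),
        Real.rpow_neg hN0.le, ← Real.sqrt_eq_rpow, ← Real.sqrt_eq_rpow]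
      ring
    calc _ ≤ (b ^ n) ^ (-q) * √(b ^ (n + 1) / N) :=
          mul_le_mul_of_nonneg_right (hdecay n) (Real.sqrt_nonneg _)
      _ = √b * N ^ (-(1 / 2) : ℝ) * ((b ^ n) ^ (-q) * (b ^ n) ^ (1 / 2 : ℝ)) := by rw [this]; ring
      _ = _ := by rw [← Real.rpow_add hbn, hθ, hpow]; ring_nf
  have hgeom : ∑ n ∈ Finset.range L, θ ^ n ≤ θ / (θ - 1) * N ^ (1 / 2 - q) := by
    have hθ0 : 0 < θ - 1 := by linarith
    rcases Nat.eq_zero_or_pos L with h0 | h0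
    · rw [h0, Finset.sum_range_zero]; positivity
    · obtain ⟨k, hk⟩ := Nat.exists_eq_succ_of_ne_zero h0.ne'
      rw [geom_sum_eq hθ1.ne', div_mul_eq_mul_div]
      refine div_le_div_of_nonneg_right ?_ hθ0.le
      have : θ ^ k ≤ N ^ (1 / 2 - q) := by
        rw [hθ, hpow]
        exact Real.rpow_le_rpow (by positivity) (hlt k (by omega)).le (by linarith)
      rw [hk, Nat.succ_eq_add_one, pow_succ]
      nlinarith
  refine ⟨L, ?_⟩
  have h1 : ((2 : ℝ) ^ (-p)) ^ L ≤ N ^ (-q) :=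
    (hdecay L).trans (Real.rpow_le_rpow_of_nonpos hN0 hNL (by linarith))
  have h2 : ∑ n ∈ Finset.range L, ((2 : ℝ) ^ (-p)) ^ n * √(b ^ (n + 1) / N) ≤
      √b * (θ / (θ - 1)) * N ^ (-q) := by
    calc _ ≤ ∑ n ∈ Finset.range L, √b * N ^ (-(1 / 2) : ℝ) * θ ^ n :=
          Finset.sum_le_sum fun n _ => hterm n
      _ ≤ √b * N ^ (-(1 / 2) : ℝ) * (θ / (θ - 1) * N ^ (1 / 2 - q)) := by
          rw [← Finset.mul_sum]
          exact mul_le_mul_of_nonneg_left hgeom (by positivity)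
      _ = √b * (θ / (θ - 1)) * (N ^ (-(1 / 2) : ℝ) * N ^ (1 / 2 - q)) := by ring
      _ = _ := by rw [← Real.rpow_add hN0]; ring_nf
  linarith

end Rate

/-! ### Dyadic cells -/

section DyadicCells

variable {m : ℕ}

/-- The index of the dyadic cell of level `n` that contains `x`. The cube of side `3 * D` centred
at `z` is cut into `2 ^ n` slabs along each axis; points outside the cube are moved into it by
periodicity, so that each point of the space has a cell. -/
noncomputable def dyadicCell (D : ℝ) (z : EuclideanSpace ℝ (Fin m)) (n : ℕ)
    (x : EuclideanSpace ℝ (Fin m)) : Fin m → Fin (2 ^ n) := fun i =>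
  ⟨⌊2 ^ n * Int.fract ((x i - z i) / (3 * D) + 1 / 2)⌋₊, by
    rw [Nat.floor_lt (mul_nonneg (by positivity) (Int.fract_nonneg _))]
    push_cast
    exact mul_lt_of_lt_one_right (by positivity) (Int.fract_lt_one _)⟩

theorem measurableSet_dyadicCell (D : ℝ) (z : EuclideanSpace ℝ (Fin m)) (n : ℕ)
    (F : Fin m → Fin (2 ^ n)) : MeasurableSet (dyadicCell D z n ⁻¹' {F}) := by
  have : dyadicCell D z n ⁻¹' {F} = ⋂ i, (fun x : EuclideanSpace ℝ (Fin m) =>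
      ⌊2 ^ n * Int.fract ((x i - z i) / (3 * D) + 1 / 2)⌋₊) ⁻¹' {(F i : ℕ)} := by
    ext x
    simp [dyadicCell, funext_iff, Fin.ext_iff]
  rw [this]
  refine MeasurableSet.iInter fun i => ?_
  have : Measurable fun x : EuclideanSpace ℝ (Fin m) =>
      ⌊2 ^ n * Int.fract ((x i - z i) / (3 * D) + 1 / 2)⌋₊ := by
    refine Nat.measurable_floor.comp (Measurable.const_mul ?_ _)
    exact Measurable.fract (by fun_prop)
  exact this (measurableSet_singleton _)

theorem dyadicCell_nested (D : ℝ) (z : EuclideanSpace ℝ (Fin m)) (n : ℕ)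
    (x y : EuclideanSpace ℝ (Fin m)) (h : dyadicCell D z (n + 1) x = dyadicCell D z (n + 1) y) :
    dyadicCell D z n x = dyadicCell D z n y := by
  -- The index at level `n` is the integer half of the index at level `n + 1`.
  have half (u : ℝ) : ⌊2 ^ n * u⌋₊ = ⌊2 ^ (n + 1) * u⌋₊ / 2 := by
    rw [← Nat.floor_div_ofNat]
    congr 1
    ring
  funext i
  have hi := congrArg Fin.val (congrFun h i)
  simp only [dyadicCell] at hi ⊢
  rw [Fin.mk.injEq, half, half, hi]

theorem norm_sub_le_of_dyadicCell_eq {D : ℝ} (hD : 0 < D) {x y z : EuclideanSpace ℝ (Fin m)}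
    (hx : ‖x - z‖ ≤ D) (hy : ‖y - z‖ ≤ D) {n : ℕ} (h : dyadicCell D z n x = dyadicCell D z n y) :
    ‖x - y‖ ≤ 3 * D * √m * (1 / 2) ^ n := by
  -- Points within distance `D` of `z` lie in the cube, where the fractional part changes nothing.
  have hfract {x : EuclideanSpace ℝ (Fin m)} (hx : ‖x - z‖ ≤ D) (i : Fin m) :
      Int.fract ((x i - z i) / (3 * D) + 1 / 2) = (x i - z i) / (3 * D) + 1 / 2 := by
    have h1 : |x i - z i| ≤ D := by
      have := PiLp.norm_apply_le (x - z) i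
      exact this.trans hx
    have h2 : |(x i - z i) / (3 * D)| ≤ 1 / 3 := by
      rw [abs_div, abs_of_pos (by positivity : 0 < 3 * D), div_le_iff₀ (by positivity)]
      linarith
    rw [abs_le] at h2
    exact Int.fract_eq_self.2 ⟨by linarith, by linarith⟩
  have hcoord (i : Fin m) : |x i - y i| ≤ 3 * D * (1 / 2) ^ n := by
    have hi := congrArg Fin.val (congrFun h i)
    simp only [dyadicCell, hfract hx, hfract hy] at hi
    set u := (x i - z i) / (3 * D) + 1 / 2 with hu
    set v := (y i - z i) / (3 * D) + 1 / 2 with hv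
    have hu0 : 0 ≤ u := by rw [hu, ← hfract hx]; exact Int.fract_nonneg _
    have hv0 : 0 ≤ v := by rw [hv, ← hfract hy]; exact Int.fract_nonneg _
    have h1 := Nat.floor_le (mul_nonneg (by positivity : (0 : ℝ) ≤ 2 ^ n) hu0)
    have h2 := Nat.floor_le (mul_nonneg (by positivity : (0 : ℝ) ≤ 2 ^ n) hv0)
    have h3 := Nat.lt_floor_add_one ((2 : ℝ) ^ n * u)
    have h4 := Nat.lt_floor_add_one ((2 : ℝ) ^ n * v)
    rw [hi] at h1 h3
    have h5 : |2 ^ n * u - 2 ^ n * v| ≤ 1 := abs_le.2 ⟨by linarith, by linarith⟩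
    rw [← mul_sub, abs_mul, abs_of_pos (by positivity : (0 : ℝ) < 2 ^ n)] at h5
    have h6 : x i - y i = 3 * D * (u - v) := by
      rw [hu, hv]; field_simp; ring
    rw [h6, abs_mul, abs_of_pos (by positivity : 0 < 3 * D)]
    refine mul_le_mul_of_nonneg_left ?_ (by positivity)
    rw [one_div, inv_pow, ← one_div, le_div_iff₀ (by positivity)]
    linarith
  rw [EuclideanSpace.norm_eq]
  refine Real.sqrt_le_iff.2 ⟨by positivity, ?_⟩
  calc ∑ i, ‖(x - y) i‖ ^ 2 ≤ ∑ _i : Fin m, (3 * D * (1 / 2) ^ n) ^ 2 :=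
        Finset.sum_le_sum fun i _ => by
          have := hcoord i
          simp only [PiLp.sub_apply, Real.norm_eq_abs]
          gcongr
    _ = _ := by
        simp only [Finset.sum_const, Finset.card_univ, Fintype.card_fin, nsmul_eq_mul, mul_pow,
          Real.sq_sqrt (Nat.cast_nonneg m)]
        ring

end DyadicCells

/-! ### Fluctuation of the mass of a cell -/

section Fluctuation

variable {E : Type*} [MeasurableSpace E] {T : ℕ}

theorem sq_integral_abs_le {Ω : Type*} [MeasurableSpace Ω] {μ : Measure Ω}
    [IsProbabilityMeasure μ] {f : Ω → ℝ} (hf : MemLp f 2 μ) :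
    (∫ ω, |f ω| ∂μ) ^ 2 ≤ ∫ ω, f ω ^ 2 ∂μ := by
  have h := variance_nonneg |f| μ
  rw [variance_eq_sub hf.abs] at h
  simpa using h

/-- A bound on the variance of the weighted number of sample points in `C`. -/
theorem integral_sq_cell_fluctuation_le (P : Fin T → Measure E) [∀ t, IsProbabilityMeasure (P t)]
    (w : Fin T → ℝ) {C : Set E} (hC : MeasurableSet C) :
    ∫ x, ((∑ t, C.indicator (fun _ => w t) (x t)) - ∑ t, w t * (P t).real C) ^ 2 ∂Measure.pi P ≤
      ∑ t, w t ^ 2 * (P t).real C := by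
  have hL (t : Fin T) : MemLp (C.indicator fun _ => w t) 2 (P t) :=
    (memLp_const (w t)).indicator hC
  have hL' (t : Fin T) : MemLp (fun x : Fin T → E => C.indicator (fun _ => w t) (x t)) 2
      (Measure.pi P) := (hL t).comp_measurePreserving (measurePreserving_eval P t)
  have hmean : ∫ x, ∑ t, C.indicator (fun _ => w t) (x t) ∂Measure.pi P =
      ∑ t, w t * (P t).real C := by
    rw [integral_finsetSum _ fun t _ => (hL' t).integrable (by norm_num)]
    refine Finset.sum_congr rfl fun t _ => ?_
    rw [integral_comp_eval (μ := P) (f := C.indicator fun _ => w t)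
      (hL t).aestronglyMeasurable, integral_indicator_const _ hC, smul_eq_mul, mul_comm]
  have hvar := variance_sum_pi hL
  rw [variance_eq_integral (by
    refine Finset.aemeasurable_sum _ fun t _ => (hL' t).aestronglyMeasurable.aemeasurable)] at hvar
  simp only [Finset.sum_apply, hmean] at hvar
  rw [hvar]
  refine Finset.sum_le_sum fun t _ => ?_
  refine (variance_le_expectation_sq (hL t).aestronglyMeasurable).trans_eq ?_
  have : (C.indicator fun _ => w t) ^ 2 = C.indicator fun _ => w t ^ 2 := by
    ext x
    by_cases h : x ∈ C <;> simp [h]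
  rw [this, integral_indicator_const _ hC, smul_eq_mul, mul_comm]

end Fluctuation

/-! ### The expected cost -/

section ExpectedCost

theorem isProbabilityMeasure_mixture {E : Type*} [MeasurableSpace E] {T : ℕ} {w : Fin T → ℝ}
    (hw : w ∈ stdSimplex ℝ (Fin T)) (P : Fin T → Measure E) [∀ t, IsProbabilityMeasure (P t)] :
    IsProbabilityMeasure (∑ t, ENNReal.ofReal (w t) • P t) :=
  ⟨by simp [Measure.finsetSum_apply, ← ENNReal.ofReal_sum_of_nonneg fun t _ => hw.1 t, hw.2]⟩

theorem measureReal_mixture {E : Type*} [MeasurableSpace E] {T : ℕ} {w : Fin T → ℝ}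
    (hw : ∀ t, 0 ≤ w t) (P : Fin T → Measure E) [∀ t, IsProbabilityMeasure (P t)] (s : Set E) :
    (∑ t, ENNReal.ofReal (w t) • P t).real s = ∑ t, w t * (P t).real s := by
  rw [measureReal_def, Measure.finsetSum_apply, ENNReal.toReal_sum]
  · simp [measureReal_def, ENNReal.toReal_ofReal (hw _)]
  · intro t _
    exact ENNReal.mul_ne_top ENNReal.ofReal_ne_top (measure_ne_top _ _)

theorem ae_mixture {E : Type*} [MeasurableSpace E] {T : ℕ} (w : Fin T → ℝ)
    {P : Fin T → Measure E} {q : E → Prop} (h : ∀ t, ∀ᵐ y ∂P t, q y) :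
    ∀ᵐ y ∂(∑ t, ENNReal.ofReal (w t) • P t), q y := by
  rw [ae_iff, Measure.finsetSum_apply]
  refine Finset.sum_eq_zero fun t _ => ?_
  rw [Measure.smul_apply, ae_iff.1 (h t), smul_zero]

/-- The expected total discrepancy over the cells of one partition, by the Cauchy-Schwarz
inequality and the disjointness of the cells. -/
theorem integrable_and_integral_sum_abs_cell_le {E κ : Type*} [MeasurableSpace E] [Fintype κ]
    [DecidableEq κ] {T : ℕ} (P : Fin T → Measure E) [∀ t, IsProbabilityMeasure (P t)]
    (w : Fin T → ℝ) {K : E → κ} (hK : ∀ F, MeasurableSet (K ⁻¹' {F})) :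
    Integrable (fun x : Fin T → E => ∑ F, |(∑ t with K (x t) = F, w t) -
      ∑ t, w t * (P t).real (K ⁻¹' {F})|) (Measure.pi P) ∧
    ∫ x, ∑ F, |(∑ t with K (x t) = F, w t) - ∑ t, w t * (P t).real (K ⁻¹' {F})| ∂Measure.pi P ≤
      √(Fintype.card κ * ∑ t, w t ^ 2) := by
  set Z : κ → (Fin T → E) → ℝ := fun F x =>
    (∑ t, (K ⁻¹' {F}).indicator (fun _ => w t) (x t)) - ∑ t, w t * (P t).real (K ⁻¹' {F}) with hZ
  have hrew (x : Fin T → E) (F : κ) : (∑ t with K (x t) = F, w t) -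
      ∑ t, w t * (P t).real (K ⁻¹' {F}) = Z F x := by
    simp only [hZ, Finset.sum_filter]
    congr 1
    refine Finset.sum_congr rfl fun t _ => ?_
    by_cases h : K (x t) = F <;> simp [h]
  have hL (F : κ) : MemLp (Z F) 2 (Measure.pi P) := by
    refine MemLp.sub (memLp_finsetSum _ fun t _ => ?_) (memLp_const _)
    exact ((memLp_const (w t)).indicator (hK F)).comp_measurePreserving
      (measurePreserving_eval P t)
  have hI (F : κ) : Integrable (fun x => |Z F x|) (Measure.pi P) :=
    ((hL F).integrable (by norm_num)).abs
  simp only [hrew]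
  refine ⟨integrable_finsetSum _ fun F _ => hI F, ?_⟩
  rw [integral_finsetSum _ fun F _ => hI F]
  refine Real.le_sqrt_of_sq_le ?_
  calc (∑ F, ∫ x, |Z F x| ∂Measure.pi P) ^ 2
      ≤ Fintype.card κ * ∑ F, (∫ x, |Z F x| ∂Measure.pi P) ^ 2 := sq_sum_le_card_mul_sum_sq
    _ ≤ Fintype.card κ * ∑ F, ∑ t, w t ^ 2 * (P t).real (K ⁻¹' {F}) := by
        gcongr with F _
        exact (sq_integral_abs_le (hL F)).trans (integral_sq_cell_fluctuation_le P w (hK F))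
    _ = Fintype.card κ * ∑ t, w t ^ 2 := by
        rw [Finset.sum_comm]
        congr 1
        refine Finset.sum_congr rfl fun t _ => ?_
        rw [← Finset.mul_sum, sum_measureReal_preimage_singleton _ fun F _ => hK F]
        simp

/-- The expected cost of transporting the weighted sample to the mixture of its laws. -/
theorem integral_semidiscreteCost_le {m T : ℕ} {p D : ℝ} (hp : 0 < p) (hD : 0 < D)
    {P : Fin T → Measure (EuclideanSpace ℝ (Fin m))} [∀ t, IsProbabilityMeasure (P t)]
    {Ξ : Set (EuclideanSpace ℝ (Fin m))} (hP : ∀ t, ∀ᵐ y ∂P t, y ∈ Ξ)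
    (hΞ : ∀ x ∈ Ξ, ∀ y ∈ Ξ, ‖x - y‖ ≤ D) (hne : Ξ.Nonempty)
    {w : Fin T → ℝ} (hw : w ∈ stdSimplex ℝ (Fin T)) (L : ℕ) :
    ∫ x, semidiscreteCost p D w (∑ t, ENNReal.ofReal (w t) • P t) x ∂Measure.pi P ≤
      (3 * D * √m) ^ p * (((2 : ℝ) ^ (-p)) ^ L + ∑ n ∈ Finset.range L, ((2 : ℝ) ^ (-p)) ^ n *
        √(((2 : ℝ) ^ m) ^ (n + 1) * ∑ t, w t ^ 2)) := by
  obtain ⟨z, hz⟩ := hne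
  set ν := ∑ t, ENNReal.ofReal (w t) • P t with hν
  have := isProbabilityMeasure_mixture hw P
  set C : ℝ := (3 * D * √m) ^ p with hC
  set η : ℕ → ℝ := fun n => C * ((2 : ℝ) ^ (-p)) ^ n with hη
  have hC0 : 0 ≤ C := by positivity
  have hη0 (n : ℕ) : 0 ≤ η n := by positivity
  have hηeq (n : ℕ) : η n = (3 * D * √m * (1 / 2) ^ n) ^ p := by
    change C * ((2 : ℝ) ^ (-p)) ^ n = _
    rw [Real.mul_rpow (by positivity) (by positivity)]
    congr 1
    rw [← Real.rpow_natCast, ← Real.rpow_natCast, ← Real.rpow_mul (by norm_num),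
      ← Real.rpow_mul (by norm_num), one_div, Real.inv_rpow (by norm_num),
      ← Real.rpow_neg (by norm_num)]
    ring_nf
  set Φ : ℕ → (Fin T → EuclideanSpace ℝ (Fin m)) → ℝ := fun n x =>
    ∑ F, |(∑ t with dyadicCell D z n (x t) = F, w t) -
      ∑ t, w t * (P t).real (dyadicCell D z n ⁻¹' {F})| with hΦ
  have hΦint (n : ℕ) := integrable_and_integral_sum_abs_cell_le P w (K := dyadicCell D z n)
    (measurableSet_dyadicCell D z n)
  have hbound : ∀ᵐ x ∂Measure.pi P, semidiscreteCost p D w ν x ≤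
      η L + ∑ n ∈ Finset.range L, η n * Φ (n + 1) x := by
    have hx : ∀ᵐ x ∂Measure.pi P, ∀ t, x t ∈ Ξ := ae_all_iff.2 fun t =>
      (measurePreserving_eval P t).quasiMeasurePreserving.ae (hP t)
    filter_upwards [hx] with x hx
    have hsub : Subsingleton (Fin m → Fin (2 ^ 0)) := by
      rw [pow_zero]; infer_instance
    have key := semidiscreteCost_le_multiscale (p := p) hp hD.le hw (ν := ν)
      (ι := fun n => Fin m → Fin (2 ^ n)) (K := dyadicCell D z)
      (measurableSet_dyadicCell D z) (dyadicCell_nested D z) hη0 (x := x) ?_ L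
    · simpa only [hν, measureReal_mixture hw.1] using key
    · filter_upwards [ae_mixture w hP] with y hy t n hn
      rw [hηeq]
      refine Real.rpow_le_rpow (le_min (norm_nonneg _) hD.le) ((min_le_left _ _).trans ?_) hp.le
      exact norm_sub_le_of_dyadicCell_eq hD (hΞ _ (hx t) _ hz) (hΞ _ hy _ hz) hn
  have hsumint : Integrable (fun x => ∑ n ∈ Finset.range L, η n * Φ (n + 1) x) (Measure.pi P) :=
    integrable_finsetSum _ fun n _ => (hΦint (n + 1)).1.const_mul _
  calc ∫ x, semidiscreteCost p D w ν x ∂Measure.pi P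
      ≤ ∫ x, η L + ∑ n ∈ Finset.range L, η n * Φ (n + 1) x ∂Measure.pi P := by
        refine integral_mono_ae ?_ ((integrable_const _).add hsumint) hbound
        refine Integrable.of_bound
          (measurable_semidiscreteCost hp hD.le w ν).aestronglyMeasurable (D ^ p)
          (.of_forall fun x => ?_)
        rw [Real.norm_of_nonneg (semidiscreteCost_nonneg hD.le _ _ _)]
        exact semidiscreteCost_le hp hD.le hw ν x
    _ = η L + ∑ n ∈ Finset.range L, η n * ∫ x, Φ (n + 1) x ∂Measure.pi P := by
        rw [integral_add (integrable_const _) hsumint, integral_finsetSum _ fun n _ =>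
          (hΦint (n + 1)).1.const_mul _]
        simp only [integral_const_mul, integral_const, probReal_univ, one_smul]
        rfl
    _ ≤ η L + ∑ n ∈ Finset.range L, η n * √(((2 : ℝ) ^ m) ^ (n + 1) * ∑ t, w t ^ 2) := by
        gcongr with n _
        refine (hΦint (n + 1)).2.trans_eq ?_
        congr 2
        simp [← pow_mul, mul_comm]
    _ = _ := by
        rw [mul_add, Finset.mul_sum]
        simp only [hη, mul_assoc]

end ExpectedCost

/-! ### Concentration -/

section Concentration

theorem one_le_effectiveSampleSize {T : ℕ} {w : Fin T → ℝ} (hw : w ∈ stdSimplex ℝ (Fin T)) :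
    1 ≤ effectiveSampleSize w := by
  have hle : ∑ t, w t ^ 2 ≤ 1 := by
    rw [← hw.2]
    refine Finset.sum_le_sum fun t _ => ?_
    have h1 : w t ≤ 1 := hw.2 ▸ Finset.single_le_sum (fun i _ => hw.1 i) (Finset.mem_univ t)
    nlinarith [hw.1 t]
  have hpos : 0 < ∑ t, w t ^ 2 := by
    refine (Finset.sum_nonneg fun t _ => sq_nonneg (w t)).lt_of_ne' fun h => ?_
    rw [Finset.sum_eq_zero_iff_of_nonneg fun t _ => sq_nonneg (w t)] at h
    have h2 := hw.2
    rw [Finset.sum_eq_zero fun t ht => pow_eq_zero_iff (two_ne_zero) |>.1 (h t ht)] at h2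
    exact zero_ne_one h2
  rw [effectiveSampleSize, one_le_div hpos]
  exact hle

/-- The bounded differences are `w t * D ^ p`, hence the variance proxy is
`D ^ (2 * p) / 4 * ∑ t, w t ^ 2`. -/
theorem measureReal_semidiscreteCost_ge_le {E : Type*} [NormedAddCommGroup E] [MeasurableSpace E]
    [BorelSpace E] [SecondCountableTopology E] {T : ℕ} {p D : ℝ} (hp : 0 < p) (hD : 0 ≤ D)
    {w : Fin T → ℝ} (hw : w ∈ stdSimplex ℝ (Fin T)) (ν : Measure E) [IsProbabilityMeasure ν]
    (P : Fin T → Measure E) [∀ t, IsProbabilityMeasure (P t)] {b s u : ℝ} (hs : 0 ≤ s)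
    (hb : ∫ x, semidiscreteCost p D w ν x ∂Measure.pi P ≤ b) (hu : b + s ≤ u) :
    (Measure.pi P).real {x | u ≤ semidiscreteCost p D w ν x} ≤
      Real.exp (-(2 / D ^ (2 * p)) * effectiveSampleSize w * s ^ 2) := by
  have hDp : 0 ≤ D ^ p := Real.rpow_nonneg hD _
  have key := hasSubgaussianMGF_of_bounded_differences P
    (measurable_semidiscreteCost hp hD w ν) (M := D ^ p)
    (fun x => by
      rw [abs_of_nonneg (semidiscreteCost_nonneg hD _ _ _)]
      exact semidiscreteCost_le hp hD hw ν x)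
    (c := fun i => Real.toNNReal (w i * D ^ p))
    (fun i x y hxy =>
      (semidiscreteCost_sub_le hp hD hw ν hxy).trans (Real.le_coe_toNNReal _))
  refine (measureReal_mono fun x hx => ?_).trans ((key.measure_ge_le hs).trans_eq ?_)
  · have hx' : u ≤ semidiscreteCost p D w ν x := hx
    change s ≤ _
    linarith
  · congr 1
    push_cast
    have h1 : ∑ i, (w i * D ^ p / 2) ^ 2 = D ^ (2 * p) / 4 * ∑ i, w i ^ 2 := by
      rw [Finset.mul_sum]
      refine Finset.sum_congr rfl fun i _ => ?_
      rw [two_mul, Real.rpow_add' hD (by linarith)]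
      ring
    simp only [Real.coe_toNNReal _ (mul_nonneg (hw.1 _) hDp), h1, effectiveSampleSize]
    rw [neg_div, neg_mul, neg_mul]
    congr 1
    ring

theorem isFiniteMeasure_weightedEmpirical {E : Type*} [MeasurableSpace E] {T : ℕ}
    (w : Fin T → ℝ) (x : Fin T → E) : IsFiniteMeasure (weightedEmpirical w x) :=
  ⟨by simp [weightedEmpirical, Measure.finsetSum_apply]⟩

/-- Reduction to the semidiscrete cost: the triangle inequality through the mixture
`∑ t, w t • P t` removes the drift. The left event need not be known to be measurable; the right
one is. -/
theorem measureReal_wassersteinDist_ge_le {m T : ℕ} {p D : ℝ} (hp : 1 ≤ p) (hD : 0 < D)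
    {P : Fin (T + 1) → Measure (EuclideanSpace ℝ (Fin m))} [∀ t, IsProbabilityMeasure (P t)]
    {Ξ : Set (EuclideanSpace ℝ (Fin m))} (hP : ∀ t, ∀ᵐ y ∂P t, y ∈ Ξ)
    (hΞ : ∀ x ∈ Ξ, ∀ y ∈ Ξ, ‖x - y‖ ≤ D)
    {ρ : ℝ} (hρ : 0 ≤ ρ)
    (hdrift : ∀ t : Fin T, wassersteinDistTop (P t.castSucc) (P t.succ) ≤ ENNReal.ofReal ρ)
    {Ω : Type*} [MeasurableSpace Ω] {μ : Measure Ω} [IsProbabilityMeasure μ]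
    {ξ : Fin T → Ω → EuclideanSpace ℝ (Fin m)} (hξ : ∀ t, HasLaw (ξ t) (P t.castSucc) μ)
    (hind : iIndepFun ξ μ) {w : Fin T → ℝ} (hw : w ∈ stdSimplex ℝ (Fin T)) {ε : ℝ}
    (hε : 0 < ε - weightedDrift p w * ρ) :
    μ.real {ω | ENNReal.ofReal ε ≤
        wassersteinDist p (weightedEmpirical w fun t => ξ t ω) (P (Fin.last T))} ≤
      (Measure.pi fun t : Fin T => P t.castSucc).real {x | (ε - weightedDrift p w * ρ) ^ p ≤
        semidiscreteCost p D w (∑ t, ENNReal.ofReal (w t) • P t.castSucc) x} := by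
  have hp0 : 0 < p := by linarith
  set ν := ∑ t, ENNReal.ofReal (w t) • P t.castSucc with hν
  have hνp : IsProbabilityMeasure ν :=
    isProbabilityMeasure_mixture hw fun t : Fin T => P t.castSucc
  have hdr0 : 0 ≤ weightedDrift p w * ρ := by
    refine mul_nonneg (Real.rpow_nonneg (Finset.sum_nonneg fun t _ => mul_nonneg (hw.1 t)
      (Real.rpow_nonneg ?_ _)) _) hρ
    have : ((t : ℕ) : ℝ) ≤ T := by exact_mod_cast t.2.le
    linarith
  have hmeas : AEMeasurable (fun ω t => ξ t ω) μ :=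
    aemeasurable_pi_lambda _ fun t => (hξ t).aemeasurable
  have hlaw : μ.map (fun ω t => ξ t ω) = Measure.pi fun t : Fin T => P t.castSucc := by
    rw [(iIndepFun_iff_map_fun_eq_pi_map fun t => (hξ t).aemeasurable).1 hind]
    simp only [(hξ _).map_eq]
  have hset : MeasurableSet {x | (ε - weightedDrift p w * ρ) ^ p ≤ semidiscreteCost p D w ν x} :=
    measurableSet_le measurable_const (measurable_semidiscreteCost hp0 hD.le w ν)
  rw [← hlaw, measureReal_def, measureReal_def, Measure.map_apply_of_aemeasurable hmeas hset]
  refine ENNReal.toReal_mono (measure_ne_top _ _) (measure_mono_ae ?_)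
  have hmem : ∀ᵐ ω ∂μ, ∀ t, ξ t ω ∈ Ξ := ae_all_iff.2 fun t =>
    ae_of_ae_map (hξ t).aemeasurable (by rw [(hξ t).map_eq]; exact hP _)
  filter_upwards [hmem] with ω hω hle
  by_contra hlt
  have hlt' : semidiscreteCost p D w ν (fun t => ξ t ω) < (ε - weightedDrift p w * ρ) ^ p :=
    not_le.1 hlt
  have h1 := wassersteinDist_weightedEmpirical_lt hp0 hD.le hw (ν := ν) (x := fun t => ξ t ω)
    (fun t => (ae_mixture w fun t : Fin T => hP t.castSucc).mono fun y hy => hΞ _ (hω t) _ hy)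
    hε hlt'
  have h2 := wassersteinDist_drift_le hp0 hρ hdrift hw
  have := isFiniteMeasure_weightedEmpirical w fun t => ξ t ω
  have h3 := (wassersteinDist_triangle hp (weightedEmpirical w fun t => ξ t ω) ν
    (P (Fin.last T))).trans_lt (ENNReal.add_lt_add_of_lt_of_le
      (ne_top_of_le_ne_top ENNReal.ofReal_ne_top h2) h1 h2)
  rw [← ENNReal.ofReal_add hε.le hdr0, sub_add_cancel] at h3
  exact h3.not_ge hle

end Concentration

theorem mainTheorem1 (p : ℝ) (hp : 1 ≤ p) (D : ℝ) :
    ∃ c₁ : ℝ, 0 < c₁ ∧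
      ∀ (m : ℕ) (_ : 0 < m) (q : ℝ) (_ : 0 < q) (_ : q < 1 / 2) (_ : q ≤ p / m),
        ∃ c₂ : ℝ, 0 < c₂ ∧
          ∀ (Ξ : Set (EuclideanSpace ℝ (Fin m))) (_ : IsClosed Ξ)
            (_ : Bornology.IsBounded Ξ) (_ : Metric.diam Ξ = D)
            (T : ℕ) (P : Fin (T + 1) → Measure (EuclideanSpace ℝ (Fin m)))
            (_ : ∀ t, IsProbabilityMeasure (P t)) (_ : ∀ t, P t Ξ = 1)
            (ρ : ℝ) (_ : 0 ≤ ρ)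
            (_ : ∀ t : Fin T, wassersteinDistTop (P t.castSucc) (P t.succ) ≤ ENNReal.ofReal ρ)
            (Ω : Type*) (_ : MeasurableSpace Ω) (μ : Measure Ω) (_ : IsProbabilityMeasure μ)
            (ξ : Fin T → Ω → EuclideanSpace ℝ (Fin m))
            (_ : ∀ t, HasLaw (ξ t) (P t.castSucc) μ) (_ : iIndepFun ξ μ)
            (w : Fin T → ℝ) (_ : w ∈ stdSimplex ℝ (Fin T)) (ε : ℝ) (_ : 0 ≤ ε),
            μ.real {ω | ENNReal.ofReal ε ≤
                wassersteinDist p (weightedEmpirical w fun t => ξ t ω) (P (Fin.last T))}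
              ≤ Real.exp (-c₁ * effectiveSampleSize w *
                  (max 0 ((max 0 (ε - weightedDrift p w * ρ)) ^ p
                    - c₂ * effectiveSampleSize w ^ (-q))) ^ 2) ∧
            (weightedDrift p w * ρ + 2 * (c₂ * effectiveSampleSize w ^ (-q)) ^ (1 / p) ≤ ε →
              μ.real {ω | ENNReal.ofReal ε ≤
                  wassersteinDist p (weightedEmpirical w fun t => ξ t ω) (P (Fin.last T))}
                ≤ Real.exp (-(c₁ / 4) * effectiveSampleSize w *
                    (max 0 (ε - weightedDrift p w * ρ)) ^ (2 * p))) := by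
  have hp0 : 0 < p := by linarith
  -- Any bound on the diameter will do; this one is also positive when `D = 0`.
  set B : ℝ := max D 1 with hB
  have hB0 : 0 < B := lt_max_of_lt_right one_pos
  refine ⟨2 / B ^ (2 * p), by positivity, fun m hm q hq0 hq hqp => ?_⟩
  set θ : ℝ := ((2 : ℝ) ^ m) ^ (1 / 2 - q) with hθ
  have hθ1 : 1 < θ := Real.one_lt_rpow (one_lt_pow₀ (by norm_num) hm.ne') (by linarith)
  have hθ0 : 0 < θ - 1 := by linarith
  set c₂ : ℝ := (3 * B * √m) ^ p * (1 + √((2 : ℝ) ^ m) * (θ / (θ - 1))) with hc₂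
  have hm0 : (0 : ℝ) < m := by exact_mod_cast hm
  have hc₂0 : 0 < c₂ := by positivity
  refine ⟨c₂, hc₂0, ?_⟩
  intro Ξ hΞc hΞb hΞd T P hPp hPΞ ρ hρ hdrift Ω _ μ _ ξ hξ hind w hw ε _
  have hP (t) : ∀ᵐ y ∂P t, y ∈ Ξ := (prob_compl_eq_zero_iff hΞc.measurableSet).2 (hPΞ t)
  have hne : Ξ.Nonempty := by
    by_contra h
    have := hPΞ 0
    rw [Set.not_nonempty_iff_eq_empty.1 h, measure_empty] at this
    exact zero_ne_one this
  have hdist : ∀ x ∈ Ξ, ∀ y ∈ Ξ, ‖x - y‖ ≤ B := fun x hx y hy => by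
    rw [← dist_eq_norm]
    exact (Metric.dist_le_diam_of_mem hΞb hx hy).trans (hΞd ▸ le_max_left _ _)
  set N : ℝ := effectiveSampleSize w with hN
  have hN1 : 1 ≤ N := one_le_effectiveSampleSize hw
  have hN0 : 0 < N := by linarith
  have hmean : ∫ x, semidiscreteCost p B w (∑ t, ENNReal.ofReal (w t) • P t.castSucc) x
      ∂(Measure.pi fun t : Fin T => P t.castSucc) ≤ c₂ * N ^ (-q) := by
    obtain ⟨L, hL⟩ := exists_level_sum_le hN1 hm hq0 hq hqp
    refine (integral_semidiscreteCost_le hp0 hB0 (fun t => hP t.castSucc) hdist hne hw L).trans ?_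
    rw [hc₂, mul_assoc ((3 * B * √m) ^ p)]
    refine mul_le_mul_of_nonneg_left (le_of_eq_of_le ?_ hL) (by positivity)
    simp only [hN, effectiveSampleSize, div_div_eq_mul_div, div_one]
  set A : ℝ := max 0 (ε - weightedDrift p w * ρ) with hA
  have hA0 : 0 ≤ A := le_max_left _ _
  set b : ℝ := c₂ * N ^ (-q) with hb
  have hb0 : 0 < b := mul_pos hc₂0 (Real.rpow_pos_of_pos hN0 _)
  have main : μ.real {ω | ENNReal.ofReal ε ≤
      wassersteinDist p (weightedEmpirical w fun t => ξ t ω) (P (Fin.last T))}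
      ≤ Real.exp (-(2 / B ^ (2 * p)) * N * (max 0 (A ^ p - b)) ^ 2) := by
    rcases le_or_gt (A ^ p - b) 0 with hs | hs
    -- For a nonpositive excess the right-hand side is `exp 0 = 1`.
    · rw [max_eq_left hs]
      simp
    · have hApos : 0 < A := by
        refine hA0.lt_of_ne fun h => ?_
        rw [← h, Real.zero_rpow hp0.ne'] at hs
        linarith
      have hAeq : A = ε - weightedDrift p w * ρ := by
        refine max_eq_right (le_of_lt ?_)
        by_contra hneg
        exact hApos.ne' (max_eq_left (not_lt.1 hneg))
      have hνp := isProbabilityMeasure_mixture hw fun t : Fin T => P t.castSucc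
      rw [max_eq_right hs.le]
      refine (measureReal_wassersteinDist_ge_le hp hB0 hP hdist hρ hdrift hξ hind hw
        (hAeq ▸ hApos)).trans ?_
      rw [← hAeq]
      exact measureReal_semidiscreteCost_ge_le hp0 hB0.le hw _ _ hs.le hmean (by linarith)
  refine ⟨main, fun hε => main.trans (Real.exp_le_exp.2 ?_)⟩
  have hr0 : 0 ≤ b ^ (1 / p) := by positivity
  have hA2 : 2 * b ^ (1 / p) ≤ A := le_max_of_le_right (by linarith)
  have hAp : 2 * b ≤ A ^ p := by
    calc 2 * b ≤ 2 ^ p * b := by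
          gcongr
          simpa using Real.rpow_le_rpow_of_exponent_le one_le_two hp
      _ = (2 * b ^ (1 / p)) ^ p := by
          rw [Real.mul_rpow zero_le_two hr0, ← Real.rpow_mul hb0.le, one_div_mul_cancel hp0.ne',
            Real.rpow_one]
      _ ≤ A ^ p := Real.rpow_le_rpow (by positivity) hA2 hp0.le
  have hsq : A ^ (2 * p) / 4 ≤ (max 0 (A ^ p - b)) ^ 2 := by
    have h1 : A ^ p / 2 ≤ max 0 (A ^ p - b) := le_max_of_le_right (by linarith)
    calc A ^ (2 * p) / 4 = (A ^ p / 2) ^ 2 := by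
          rw [two_mul, Real.rpow_add' hA0 (by linarith)]; ring
      _ ≤ _ := pow_le_pow_left₀ (by positivity) h1 2
  have := mul_le_mul_of_nonneg_left hsq
    (by positivity : 0 ≤ 2 / B ^ (2 * p) * N)
  linarith
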